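/- Let $0<\alpha\le 1$, $\tau>0$, $\delta\in\mathbb R$. Consider the time-fractional heat equation with delay $$\frac{\partial^\alpha u}{\partial t^\alpha}=D(u)\,u_{xx}+R(u,\bar u),\quad x\in\mathbb R,\ t>0,\qquad u(x,t)=\Psi(x,t),\ t\in[-\tau,0],\qquad(\ast)$$ where $\bar u=u(x,t-\tau)$ and $\partial^\alpha/\partial t^\alpha$ is the Caputo derivative with base point $0$, that is $\varphi'(t)$ for $\alpha=1$ and $\frac1{\Gamma(1-\alpha)}\int_0^t(t-s)^{-\alpha}\varphi'(s)\,ds$ for $\alpha<1$. A solution is a function $u$ which equals $\Psi$ for $t\in[-\tau,0]$, is absolutely continuous in $t$ on $[-\tau,T]$ for all $T>0$ and $x\in\mathbb R$, is $C^2$ in $x$ for every $t>0$, and satisfies the equation at every $x\in\mathbb R$, $t>0$ (for $\alpha<1$ with an absolutely convergent Caputo integral). Let $E_{\alpha,\beta}^{\gamma}(z)=\sum_{k\ge0}\frac{(\gamma)_k z^k}{\Gamma(\alpha k+\beta)\,k!}$ with $(\gamma)_k=\Gamma(\gamma+k)/\Gamma(\gamma)$ be the Prabhakar function and let $g(t)=1$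 for $t<0$, $g(t)=0$ for $t\ge0$. For $\kappa\in\mathbb R$, a constant $c$ and a function $\psi$ on $[-\tau,0]$, let $A[\kappa,c,\psi](t)=\psi(t)$ for $t\in[-\tau,0]$ and, for $t>0$, $$\begin{aligned}A[\kappa,c,\psi](t)={}&\psi(0)\sum_{n=0}^{\lfloor t/\tau\rfloor}\delta^n(t-n\tau)^{\alpha n}E_{\alpha,\alpha n+1}^{n+1}(\kappa(t-n\tau)^\alpha)\\&+\int_0^t\Big[\sum_{n=0}^{\lfloor r/\tau\rfloor}\delta^{n+1}(r-n\tau)^{\alpha n+\alpha-1}E_{\alpha,\alpha n+\alpha}^{n+1}(\kappa(r-n\tau)^\alpha)\Big]\psi(t-\tau-r)\,g(t-\tau-r)\,dr\\&+c\sum_{n=0}^{\lfloor t/\tau\rfloor}\delta^n(t-n\tau)^{\alpha(n+1)}E_{\alpha,\alpha n+\alpha+1}^{n+1}(\kappa(t-n\tau)^\alpha).\end{aligned}$$ All history functions $\xi,\psi,\chi,\omega$ below are absolutely continuous on $[-\tau,0]$. They are real-valued, except in the last sentence of (3). A linear space $W$ of functions of $x$ is called invariant if $D(w)w_{xx}+R(w,\bar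 w)\in W$ for all $w,\bar w\in W$. (1) Let $m\ge0$ be an integer, $a_0,b_0,\dots,b_m,c_1,\dots,c_{m+1}\in\mathbb R$ with $c_{k+1}=-a_0^2b_k$ for $k=1,\dots,m$, $D(u)=\sum_{k=0}^m b_ku^k$ and $R(u,\bar u)=\sum_{k=0}^{m}c_{k+1}u^{k+1}+\delta\bar u$. Then $\mathrm{Span}\{e^{-a_0x}\}$ is invariant, and $u(x,t)=A[\beta,0,\xi](t)\,e^{-a_0x}$ with $\beta=a_0^2b_0+c_1$ is a solution of $(\ast)$ with $\Psi(x,t)=\xi(t)e^{-a_0x}$. (2) Let $D:\mathbb R\to\mathbb R$ be an arbitrary function and $R(u,\bar u)=c_1u+\delta\bar u+c_0$ with $c_0,c_1\in\mathbb R$. Then $\mathrm{Span}\{1,x\}$ is invariant, and $u(x,t)=A_1(t)+A_2(t)x$ with $A_1=A[c_1,c_0,\psi]$, $A_2=A[c_1,0,\chi]$ is a solution of $(\ast)$ with $\Psi(x,t)=\psi(t)+\chi(t)x$. (3) Let $a_0,b_0,b_1,b_2,c_1\in\mathbb R$, $D(u)=b_2u^2+b_1u+b_0$, $R(u,\bar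 u)=a_0b_2u^3+a_0b_1u^2+c_1u+\delta\bar u$ and $\lambda=c_1-a_0b_0$. If $a_0\ge0$, then $\mathrm{Span}\{\cos(\sqrt{a_0}x),\sin(\sqrt{a_0}x)\}$ is invariant, and $u(x,t)=A_1(t)\cos(\sqrt{a_0}x)+A_2(t)\sin(\sqrt{a_0}x)$ with $A_1=A[\lambda,0,\chi]$, $A_2=A[\lambda,0,\omega]$ is a solution of $(\ast)$ with $\Psi(x,t)=\chi(t)\cos(\sqrt{a_0}x)+\omega(t)\sin(\sqrt{a_0}x)$. For $a_0\in\mathbb R$ of any sign, if $\sqrt{a_0}$ denotes either complex square root of $a_0$ and $\chi,\omega$ are complex-valued, the same $u$ is a complex-valued solution of $(\ast)$ with this $\Psi$. -/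

import Mathlib

noncomputable section

/-- The three-parameter Mittag-Leffler (Prabhakar) function
`E_{α,β}^γ(z) = ∑ (γ)_k z ^ k / (Γ(α k + β) k!)`, `(γ)_k = Γ(γ + k) / Γ(γ)`,
for real arguments and positive parameters. -/
def prabhakar (α β γ z : ℝ) : ℝ :=
  ∑' k : ℕ, Real.Gamma (γ + k) / Real.Gamma γ * z ^ k /
    (Real.Gamma (α * k + β) * (k.factorial : ℝ))

/-- `∑_{n = 0}^{⌊t/τ⌋} δ ^ n (t - n τ) ^ (α n + ρ - 1) E_{α, α n + ρ}^{n + 1}(κ (t - n τ) ^ α)`. -/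
def delaySeries (α τ κ δ ρ t : ℝ) : ℝ :=
  ∑ n ∈ Finset.range (⌊t / τ⌋₊ + 1),
    δ ^ n * (t - n * τ) ^ (α * n + ρ - 1) *
      prabhakar α (α * n + ρ) (n + 1) (κ * (t - n * τ) ^ α)

/-- The cut-off `g`: `0` on `[0, ∞)` and `1` on `(-∞, 0)`. -/
def pastCutoff (t : ℝ) : ℝ := if 0 ≤ t then 0 else 1

/-- The convolution `∫_0^t φ₁(r) φ₂(t - r) dr`. -/
def convol {𝕜 : Type*} [RCLike 𝕜] (φ₁ : ℝ → ℝ) (φ₂ : ℝ → 𝕜) (t : ℝ) : 𝕜 :=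
  ∫ r in (0 : ℝ)..t, φ₁ r • φ₂ (t - r)

/-- The coefficient function with history `ψ`: it is `ψ(t)` for `t ≤ 0`, and for `t > 0` the sum of
`ψ(0) ∑ δ^n (t - nτ)^{αn} E_{α,αn+1}^{n+1}(κ (t - nτ)^α)`, of the convolution of
`∑ δ^{n+1} (t - nτ)^{αn+α-1} E_{α,αn+α}^{n+1}(κ (t - nτ)^α)` with `ψ(t - τ) g(t - τ)`, and of
`∑ c₀ δ^n (t - nτ)^{α(n+1)} E_{α,αn+α+1}^{n+1}(κ (t - nτ)^α)`,
where all sums run over `0 ≤ n ≤ ⌊t/τ⌋`. -/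
def delayCoeff {𝕜 : Type*} [RCLike 𝕜] (α τ κ δ : ℝ) (c₀ : 𝕜) (ψ : ℝ → 𝕜) (t : ℝ) : 𝕜 :=
  if t ≤ 0 then ψ t
  else
    delaySeries α τ κ δ 1 t • ψ 0
      + convol (fun r => δ * delaySeries α τ κ δ α r)
          (fun r => pastCutoff (r - τ) • ψ (r - τ)) t
      + delaySeries α τ κ δ (α + 1) t • c₀

/-- `φ` has Caputo derivative `v` of order `α ∈ (0, 1]` (with base point `0`) at `t`:
for `α = 1` this is the ordinary derivative, for `α < 1` it is
`Γ(1 - α)⁻¹ ∫_0^t φ'(s) (t - s)^{-α} ds`, as an absolutely convergent integral. It is meant for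
functions that are absolutely continuous on `[0, t]`, so that `φ'` exists almost everywhere. -/
def HasCaputoDeriv {𝕜 : Type*} [RCLike 𝕜] (α : ℝ) (φ : ℝ → 𝕜) (t : ℝ) (v : 𝕜) : Prop :=
  if α = 1 then HasDerivAt φ v t
  else
    IntervalIntegrable (fun s => (t - s) ^ (-α) • deriv φ s) MeasureTheory.volume 0 t ∧
      (Real.Gamma (1 - α))⁻¹ • (∫ s in (0 : ℝ)..t, (t - s) ^ (-α) • deriv φ s) = v

/-- The operator `H[w, w̄] = D(w) w_xx + R(w, w̄)`. -/
def heatOp {𝕜 : Type*} [RCLike 𝕜] (D : 𝕜 → 𝕜) (R : 𝕜 → 𝕜 → 𝕜) (w wbar : ℝ → 𝕜) (x : ℝ) : 𝕜 :=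
  D (w x) * iteratedDeriv 2 w x + R (w x) (wbar x)

/-- The space `W` is invariant under `H`: `H[w, w̄] ∈ W` for all `w, w̄ ∈ W`. -/
def IsInvariantSubspace (W : Submodule ℝ (ℝ → ℝ)) (D : ℝ → ℝ) (R : ℝ → ℝ → ℝ) : Prop :=
  ∀ w ∈ W, ∀ wbar ∈ W, heatOp D R w wbar ∈ W

/-- `u = u x t` is a solution of the time-fractional heat equation with delay
`∂_t^α u = D(u) u_xx + R(u, u(x, t - τ))`, `x ∈ ℝ`, `t > 0`, with history
`u(x, t) = Ψ(x, t)` for `t ∈ [-τ, 0]`. -/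
structure IsDelayHeatSolution {𝕜 : Type*} [RCLike 𝕜] (α τ : ℝ) (D : 𝕜 → 𝕜) (R : 𝕜 → 𝕜 → 𝕜)
    (Ψ u : ℝ → ℝ → 𝕜) : Prop where
  history : ∀ x t, t ∈ Set.Icc (-τ) 0 → u x t = Ψ x t
  absCont : ∀ x T, 0 < T → AbsolutelyContinuousOnInterval (fun t => u x t) (-τ) T
  smooth : ∀ t, 0 < t → ContDiff ℝ 2 (fun x => u x t)
  equation : ∀ x t, 0 < t →
    HasCaputoDeriv α (fun s => u x s) t
      (heatOp D R (fun y => u y t) (fun y => u y (t - τ)) x)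

end

/-! On each space considered, `heatOp` acts on the coordinates by separate affine maps: the
nonlinear parts of D(w) w_xx and R(w, w̄) cancel (`heatOp_exp`, `heatOp_of_eigen`), or w_xx vanishes
(`heatOp_affine`). Invariance follows, and the equation reduces to scalar equations ∂^α A = κ A + δ
A(· - τ) + c₀ for the coefficients (`isDelayHeatSolution_of_heatOp_eq`).

For the scalar equation, write p_ν for `powKernel` and K_ρ for `delayKernel`. Two identities carry
the argument: p_ν * K_ρ = K_{ρ+ν}, from the Beta integral, and K_ρ = p_ρ + κ K_{ρ+α} + δ K_{ρ+α}(· -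
τ) before time N τ, from Pascal's rule. The absolutely continuous history, shifted by τ, has an
integrable density c, and the coefficient function becomes A = ψ(0) + K_{α+1} C + δ K_{α+1} * c with
C = κ ψ(0) + δ ψ(-τ) + c₀ (`delayCoeff_eq_delayKernel`).

By the first identity, A is ψ(0) plus the integral of G = K_α C + δ K_α * c, and for α < 1 the
fractional integral of G of order 1 - α is K_1 C + δ K_1 * c. The second identity turns this into
the right-hand side of the equation (`delayCoeff_representation`). For α < 1 it remains that A' = G
almost everywhere; for α = 1, G is itself the right-hand side, hence continuous, and the fundamental
theorem of calculus applies at every t > 0. -/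

section

open MeasureTheory Filter Topology Set

/-! ### Riemann-Liouville kernels -/

/-- The Riemann-Liouville kernel `t ^ (β - 1) / Γ(β)`, extended by `0` to `t ≤ 0`. -/
noncomputable def powKernel (β t : ℝ) : ℝ := if 0 < t then t ^ (β - 1) / Real.Gamma β else 0

lemma powKernel_of_nonpos {β t : ℝ} (ht : t ≤ 0) : powKernel β t = 0 := if_neg ht.not_gt

lemma powKernel_of_pos {β t : ℝ} (ht : 0 < t) :
    powKernel β t = t ^ (β - 1) / Real.Gamma β := if_pos ht

lemma powKernel_one {t : ℝ} (ht : 0 < t) : powKernel 1 t = 1 := by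
  simp [powKernel_of_pos ht]

lemma powKernel_pos {β t : ℝ} (hβ : 0 < β) (ht : 0 < t) : 0 < powKernel β t := by
  rw [powKernel_of_pos ht]
  exact div_pos (Real.rpow_pos_of_pos ht _) (Real.Gamma_pos_of_pos hβ)

lemma powKernel_nonneg {β : ℝ} (hβ : 0 < β) (t : ℝ) : 0 ≤ powKernel β t := by
  rcases le_or_gt t 0 with ht | ht
  · rw [powKernel_of_nonpos ht]
  · exact (powKernel_pos hβ ht).le

lemma measurable_powKernel (β : ℝ) : Measurable (powKernel β) :=
  Measurable.ite measurableSet_Ioi (by fun_prop) measurable_const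

lemma powKernel_mono {β : ℝ} (hβ : 1 ≤ β) : Monotone (powKernel β) := by
  intro s t hst
  rcases le_or_gt s 0 with hs | hs
  · rw [powKernel_of_nonpos hs]
    exact powKernel_nonneg (by linarith) t
  · rw [powKernel_of_pos hs, powKernel_of_pos (hs.trans_le hst)]
    have := Real.Gamma_pos_of_pos (show 0 < β by linarith)
    gcongr

lemma integral_powKernel_mul_powKernel {μ ν : ℝ} (hμ : 0 < μ) (hν : 0 < ν) (u : ℝ) :
    ∫ s, powKernel μ (u - s) * powKernel ν s = powKernel (ν + μ) u := by
  rcases le_or_gt u 0 with hu | hu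
  · rw [powKernel_of_nonpos hu, ← integral_zero ℝ ℝ]
    congr 1
    ext s
    rcases le_or_gt s 0 with hs | hs
    · rw [powKernel_of_nonpos hs, mul_zero]
    · rw [powKernel_of_nonpos (by linarith), zero_mul]
  have key : ∫ x in (0 : ℝ)..u, x ^ (ν - 1) * (u - x) ^ (μ - 1) =
      u ^ (ν + μ - 1) * ProbabilityTheory.beta ν μ := by
    have h := Complex.betaIntegral_scaled (ν : ℂ) (μ : ℂ) hu
    have h2 : ∫ x in (0 : ℝ)..u, (x : ℂ) ^ ((ν : ℂ) - 1) * ((u : ℂ) - x) ^ ((μ : ℂ) - 1) =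
        ((∫ x in (0 : ℝ)..u, x ^ (ν - 1) * (u - x) ^ (μ - 1) : ℝ) : ℂ) := by
      rw [← intervalIntegral.integral_ofReal]
      refine intervalIntegral.integral_congr fun x hx => ?_
      rw [uIcc_of_le hu.le] at hx
      rw [Complex.ofReal_mul, Complex.ofReal_cpow hx.1, Complex.ofReal_cpow (by linarith [hx.2])]
      push_cast
      rfl
    rw [h2] at h
    have h3 := congrArg Complex.re h
    rw [Complex.ofReal_re] at h3
    have h4 : (u : ℂ) ^ ((ν : ℂ) + μ - 1) = ((u ^ (ν + μ - 1) : ℝ) : ℂ) := by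
      rw [Complex.ofReal_cpow hu.le]
      push_cast
      rfl
    rw [h3, h4, Complex.re_ofReal_mul, ProbabilityTheory.beta_eq_betaIntegralReal ν μ hν hμ]
  have hΓμ := Real.Gamma_pos_of_pos hμ
  have hΓν := Real.Gamma_pos_of_pos hν
  have hΓ := Real.Gamma_pos_of_pos (add_pos hν hμ)
  have e1 : ∀ s, powKernel μ (u - s) * powKernel ν s = (Ioo 0 u).indicator
      (fun s => (Real.Gamma μ * Real.Gamma ν)⁻¹ * (s ^ (ν - 1) * (u - s) ^ (μ - 1))) s := by
    intro s
    by_cases hs : s ∈ Ioo 0 u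
    · rw [indicator_of_mem hs, powKernel_of_pos hs.1, powKernel_of_pos (by linarith [hs.2])]
      field_simp
    · rw [indicator_of_notMem hs]
      rcases le_or_gt s 0 with h | h
      · rw [powKernel_of_nonpos h, mul_zero]
      · rw [powKernel_of_nonpos (β := μ), zero_mul]
        by_contra! h'
        exact hs ⟨h, by linarith⟩
  simp_rw [e1]
  rw [integral_indicator measurableSet_Ioo, integral_const_mul, ← integral_Ioc_eq_integral_Ioo,
    ← intervalIntegral.integral_of_le hu.le, key, powKernel_of_pos hu, ProbabilityTheory.beta]
  field_simp

/-- A nonintegrable function has integral `0` by convention, whereas the Beta formula gives a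
positive value when `u > 0`; this forces integrability. -/
lemma integrable_powKernel_mul_powKernel {μ ν : ℝ} (hμ : 0 < μ) (hν : 0 < ν) (u : ℝ) :
    Integrable fun s => powKernel μ (u - s) * powKernel ν s := by
  rcases le_or_gt u 0 with hu | hu
  · refine (integrable_zero ℝ ℝ volume).congr (Eventually.of_forall fun s => ?_)
    rcases le_or_gt s 0 with hs | hs
    · simp [powKernel_of_nonpos hs]
    · simp [powKernel_of_nonpos (show u - s ≤ 0 by linarith)]
  · by_contra h
    have := integral_undef h
    rw [integral_powKernel_mul_powKernel hμ hν] at this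
    exact (powKernel_pos (add_pos hν hμ) hu).ne' this

/-! ### Prabhakar kernels -/

/-- Restrict the Gamma integral to `(M, M + 1]`. As `M` is free, Γ outgrows every exponential. -/
lemma rpow_mul_exp_neg_le_Gamma {M x : ℝ} (hM : 0 < M) (hx : 1 ≤ x) :
    M ^ (x - 1) * Real.exp (-(M + 1)) ≤ Real.Gamma x := by
  have hx0 : 0 < x := by linarith
  rw [Real.Gamma_eq_integral hx0]
  have hint := Real.GammaIntegral_convergent hx0
  have h1 : ∫ t in Ioc M (M + 1), M ^ (x - 1) * Real.exp (-(M + 1)) =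
      M ^ (x - 1) * Real.exp (-(M + 1)) := by simp
  rw [← h1]
  have hsub : Ioc M (M + 1) ⊆ Ioi 0 := fun t ht => hM.trans ht.1
  calc _ ≤ ∫ t in Ioc M (M + 1), Real.exp (-t) * t ^ (x - 1) := by
        refine setIntegral_mono_on (integrableOn_const (by simp)) (hint.mono_set hsub)
          measurableSet_Ioc fun t ht => ?_
        rw [mul_comm]
        have := ht.1.le
        have := ht.2
        have : 0 ≤ x - 1 := by linarith
        gcongr
    _ ≤ _ := by
        refine setIntegral_mono_set hint ?_ hsub.eventuallyLE
        refine (ae_restrict_iff' measurableSet_Ioi).2 (Eventually.of_forall fun t ht => ?_)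
        have : (0 : ℝ) < t := ht
        simp only [Pi.zero_apply]
        positivity

/-- The series coefficients are summable against the Riemann-Liouville kernels. -/
lemma summable_prabKernel {α β : ℝ} (hα : 0 < α) (hβ : 0 < β) (κ : ℝ) (n : ℕ) (t : ℝ) :
    Summable fun k : ℕ => ((n + k).choose n : ℝ) * κ ^ k * powKernel (α * k + β) t := by
  rcases le_or_gt t 0 with ht | ht
  · simp [powKernel_of_nonpos ht, summable_zero]
  -- This `M` makes `M ^ α` exceed `|κ| * t ^ α`, so that the terms are dominated by a binomial
  -- series of ratio `r < 1`.
  set M : ℝ := (2 * |κ| * t ^ α + 1) ^ (1 / α) with hMdef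
  have hb : 0 < 2 * |κ| * t ^ α + 1 := by positivity
  have hM : 0 < M := Real.rpow_pos_of_pos hb _
  have hMα : M ^ α = 2 * |κ| * t ^ α + 1 := by
    rw [hMdef, ← Real.rpow_mul hb.le, one_div_mul_cancel hα.ne', Real.rpow_one]
  set r : ℝ := |κ| * t ^ α / M ^ α with hr
  have hr0 : 0 ≤ r := by positivity
  have hr1 : r < 1 := by
    rw [hr, div_lt_one (by positivity), hMα]
    nlinarith [abs_nonneg κ, Real.rpow_pos_of_pos ht α, mul_nonneg (abs_nonneg κ)
      (Real.rpow_pos_of_pos ht α).le]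
  have hs := (summable_choose_mul_geometric_of_norm_lt_one n
    (r := r) (by rwa [Real.norm_of_nonneg hr0])).mul_left
    (t ^ (β - 1) * M ^ (1 - β) * Real.exp (M + 1))
  refine Summable.of_norm_bounded_eventually_nat hs ?_
  filter_upwards [eventually_ge_atTop ⌈1 / α⌉₊] with k hk
  have hk1 : 1 ≤ α * k + β := by
    have : 1 / α ≤ k := (Nat.le_ceil _).trans (by exact_mod_cast hk)
    rw [div_le_iff₀ hα] at this
    linarith
  have hG := rpow_mul_exp_neg_le_Gamma hM hk1
  have hlow : 0 < M ^ (α * k + β - 1) * Real.exp (-(M + 1)) := by positivity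
  rw [powKernel_of_pos ht, norm_mul, norm_mul, norm_pow, Real.norm_natCast, Real.norm_eq_abs,
    Real.norm_of_nonneg (div_nonneg (by positivity) (hlow.le.trans hG)), add_comm n k]
  calc ((k + n).choose n : ℝ) * |κ| ^ k * (t ^ (α * k + β - 1) / Real.Gamma (α * k + β))
      ≤ ((k + n).choose n : ℝ) * |κ| ^ k *
        (t ^ (α * k + β - 1) / (M ^ (α * k + β - 1) * Real.exp (-(M + 1)))) := by gcongr
    _ = _ := by
      have e1 : t ^ (α * k + β - 1) = (t ^ α) ^ k * t ^ (β - 1) := by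
        rw [← Real.rpow_natCast, ← Real.rpow_mul ht.le, ← Real.rpow_add ht]
        congr 1; ring
      have e2 : M ^ (α * k + β - 1) = (M ^ α) ^ k * (M ^ (1 - β))⁻¹ := by
        rw [← Real.rpow_natCast, ← Real.rpow_mul hM.le, ← Real.rpow_neg hM.le, ← Real.rpow_add hM]
        congr 1; ring
      rw [e1, e2, hr, Real.exp_neg, div_pow, mul_pow]
      field_simp

/-- The Prabhakar kernel `t ^ (β - 1) E_{α,β}^{n+1}(κ t ^ α)`, extended by `0` to `t ≤ 0`. -/
noncomputable def prabKernel (α κ β : ℝ) (n : ℕ) (t : ℝ) : ℝ :=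
  ∑' k : ℕ, ((n + k).choose n : ℝ) * κ ^ k * powKernel (α * k + β) t

section PrabKernel
variable {α β ν : ℝ}

lemma prabKernel_of_nonpos {κ t : ℝ} {n : ℕ} (ht : t ≤ 0) : prabKernel α κ β n t = 0 := by
  simp [prabKernel, powKernel_of_nonpos ht]

lemma prabKernel_of_pos {κ t : ℝ} {n : ℕ} (ht : 0 < t) :
    prabKernel α κ β n t = t ^ (β - 1) * prabhakar α β (n + 1) (κ * t ^ α) := by
  rw [prabKernel, prabhakar, ← tsum_mul_left]
  refine tsum_congr fun k => ?_
  rw [powKernel_of_pos ht]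
  have e1 : t ^ (α * k + β - 1) = (t ^ α) ^ k * t ^ (β - 1) := by
    rw [← Real.rpow_natCast, ← Real.rpow_mul ht.le, ← Real.rpow_add ht]
    congr 1; ring
  have e2 : Real.Gamma ((n : ℝ) + 1 + k) = ((n + k).factorial : ℝ) := by
    rw [← Real.Gamma_nat_eq_factorial]
    push_cast
    congr 1; ring
  have e3 : ((n + k).factorial : ℝ) = (n + k).choose n * n.factorial * k.factorial := by
    rw [Nat.choose_symm_add]
    exact_mod_cast (Nat.add_choose_mul_factorial_mul_factorial n k).symm
  rw [e1, e2, e3, Real.Gamma_nat_eq_factorial, mul_pow]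
  have h1 : (n.factorial : ℝ) ≠ 0 := by positivity
  have h2 : (k.factorial : ℝ) ≠ 0 := by positivity
  field_simp

lemma measurable_prabKernel (hα : 0 < α) (hβ : 0 < β) (κ : ℝ) (n : ℕ) :
    Measurable (prabKernel α κ β n) := by
  refine measurable_of_tendsto_metrizable (f := fun N t => ∑ k ∈ Finset.range N,
    ((n + k).choose n : ℝ) * κ ^ k * powKernel (α * k + β) t) (fun N => ?_) ?_
  · exact Finset.measurable_fun_sum _ fun k _ => (measurable_powKernel _).const_mul _
  · exact tendsto_pi_nhds.2 fun t =>
      (summable_prabKernel hα hβ κ n t).hasSum.tendsto_sum_nat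

lemma norm_prabKernel_coeff_mul (hα : 0 < α) (hβ : 0 < β) (κ : ℝ) (n k : ℕ) (t : ℝ) :
    ‖((n + k).choose n : ℝ) * κ ^ k * powKernel (α * k + β) t‖ =
      ((n + k).choose n : ℝ) * |κ| ^ k * powKernel (α * k + β) t := by
  rw [norm_mul, norm_mul, norm_pow, Real.norm_natCast, Real.norm_eq_abs,
    Real.norm_of_nonneg (powKernel_nonneg (by positivity) t)]

/-- The majorant has nonnegative terms, and for `1 ≤ β` it is monotone (`prabKernel_abs_mono`), so
its value at one time bounds the kernel at all earlier ones. -/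
lemma abs_prabKernel_le (hα : 0 < α) (hβ : 0 < β) (κ : ℝ) (n : ℕ) (t : ℝ) :
    |prabKernel α κ β n t| ≤ prabKernel α |κ| β n t := by
  have h := norm_tsum_le_tsum_norm (f := fun k : ℕ =>
    ((n + k).choose n : ℝ) * κ ^ k * powKernel (α * k + β) t) (by
      simp_rw [norm_prabKernel_coeff_mul hα hβ]
      exact summable_prabKernel hα hβ |κ| n t)
  simp_rw [norm_prabKernel_coeff_mul hα hβ] at h
  exact h

lemma prabKernel_abs_mono (hα : 0 < α) (hβ : 1 ≤ β) (κ : ℝ) (n : ℕ) :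
    Monotone (prabKernel α |κ| β n) := by
  intro s t hst
  refine Summable.tsum_le_tsum (fun k => ?_) (summable_prabKernel hα (by linarith) _ n s)
    (summable_prabKernel hα (by linarith) _ n t)
  have : 0 ≤ α * k := by positivity
  have := powKernel_mono (show 1 ≤ α * k + β by linarith) hst
  gcongr

lemma prabKernel_abs_pos (hα : 0 < α) (hβ : 0 < β) (κ : ℝ) (n : ℕ) {t : ℝ} (ht : 0 < t) :
    0 < prabKernel α |κ| β n t := by
  refine (summable_prabKernel hα hβ |κ| n t).tsum_pos (fun k => ?_) 0 ?_
  · have := powKernel_nonneg (show 0 < α * k + β by positivity) t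
    positivity
  · have := powKernel_pos hβ ht
    simpa using this

/-- Termwise integration is allowed because the integrals of the norms form the series with `|κ|` in
place of `κ`, which converges at `u`. -/
lemma integral_powKernel_mul_prabKernel (hα : 0 < α) (hβ : 0 < β) (hν : 0 < ν) (κ : ℝ) (n : ℕ)
    (u : ℝ) :
    ∫ s, powKernel ν (u - s) * prabKernel α κ β n s = prabKernel α κ (β + ν) n u := by
  have hpos : ∀ k : ℕ, 0 < α * k + β := fun k => by positivity
  have hint : ∀ (κ' : ℝ) (k : ℕ), ∫ s, ((n + k).choose n : ℝ) * κ' ^ k *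
      (powKernel ν (u - s) * powKernel (α * k + β) s) =
      ((n + k).choose n : ℝ) * κ' ^ k * powKernel (α * k + (β + ν)) u := fun κ' k => by
    rw [integral_const_mul, integral_powKernel_mul_powKernel hν (hpos k), add_assoc]
  have h := (hasSum_integral_of_summable_integral_norm (μ := volume)
    (F := fun (k : ℕ) s => ((n + k).choose n : ℝ) * κ ^ k *
      (powKernel ν (u - s) * powKernel (α * k + β) s))
    (fun k => (integrable_powKernel_mul_powKernel hν (hpos k) u).const_mul _) ?_).tsum_eq
  · simp_rw [hint] at h
    rw [prabKernel, h]
    congr 1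
    ext s
    rw [prabKernel, ← tsum_mul_left]
    refine tsum_congr fun k => ?_
    ring
  · have e : ∀ k s, ‖((n + k).choose n : ℝ) * κ ^ k *
        (powKernel ν (u - s) * powKernel (α * k + β) s)‖ = ((n + k).choose n : ℝ) * |κ| ^ k *
        (powKernel ν (u - s) * powKernel (α * k + β) s) := fun k s => by
      rw [norm_mul, norm_mul, norm_pow, Real.norm_natCast, Real.norm_eq_abs, Real.norm_of_nonneg
        (mul_nonneg (powKernel_nonneg hν _) (powKernel_nonneg (hpos k) s))]
    simp_rw [e, hint]
    exact summable_prabKernel hα (by positivity) _ n u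

lemma integrable_powKernel_mul_prabKernel (hα : 0 < α) (hβ : 0 < β) (hν : 0 < ν) (κ : ℝ) (n : ℕ)
    (u : ℝ) : Integrable fun s => powKernel ν (u - s) * prabKernel α κ β n s := by
  have habs : Integrable fun s => powKernel ν (u - s) * prabKernel α |κ| β n s := by
    rcases le_or_gt u 0 with hu | hu
    · refine (integrable_zero ℝ ℝ volume).congr (Eventually.of_forall fun s => ?_)
      rcases le_or_gt s 0 with hs | hs
      · simp [prabKernel_of_nonpos hs]
      · simp [powKernel_of_nonpos (show u - s ≤ 0 by linarith)]
    · by_contra h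
      have := integral_undef h
      rw [integral_powKernel_mul_prabKernel hα hβ hν] at this
      exact (prabKernel_abs_pos hα (add_pos hβ hν) κ n hu).ne' this
  refine habs.mono' ?_ (Eventually.of_forall fun s => ?_)
  · have := measurable_powKernel ν
    have := measurable_prabKernel hα hβ κ n
    fun_prop
  · rw [norm_mul, Real.norm_of_nonneg (powKernel_nonneg hν _)]
    exact mul_le_mul_of_nonneg_left (abs_prabKernel_le hα hβ κ n s) (powKernel_nonneg hν _)

lemma prabKernel_zero_eq (hα : 0 < α) (hβ : 0 < β) (κ t : ℝ) :
    prabKernel α κ β 0 t = powKernel β t + κ * prabKernel α κ (β + α) 0 t := by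
  rw [prabKernel, (summable_prabKernel hα hβ κ 0 t).tsum_eq_zero_add, prabKernel, ← tsum_mul_left]
  congr 1
  · simp
  · refine tsum_congr fun k => ?_
    rw [show α * ((k + 1 : ℕ) : ℝ) + β = α * k + (β + α) by push_cast; ring]
    simp only [Nat.choose_zero_right]
    ring

/-- Pascal's rule for the coefficients. In Laplace variables, s^{-β} (1 - κ s^{-α})^{-(n+2)} is
multiplied by 1 - κ s^{-α}. -/
lemma prabKernel_succ_eq (hα : 0 < α) (hβ : 0 < β) (κ t : ℝ) (n : ℕ) :
    prabKernel α κ β (n + 1) t =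
      prabKernel α κ β n t + κ * prabKernel α κ (β + α) (n + 1) t := by
  have h1 := summable_prabKernel hα hβ κ n t
  have h2 := (summable_prabKernel hα (add_pos hβ hα) κ (n + 1) t).mul_left κ
  have h3 := (summable_prabKernel hα hβ κ (n + 1) t).tsum_eq_zero_add
  rw [show (((n + 1 + 0).choose (n + 1) : ℕ) : ℝ) = ((n + 0).choose n : ℕ) by simp] at h3
  have h4 := h1.tsum_eq_zero_add
  have h5 := ((summable_nat_add_iff 1).2 h1).tsum_add h2
  rw [tsum_mul_left] at h5
  refine h3.trans (Eq.trans ?_ (congrArg (· + κ * prabKernel α κ (β + α) (n + 1) t) h4.symm))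
  refine Eq.trans (congrArg _ ?_) ((congrArg _ h5).trans (add_assoc _ _ _).symm)
  · refine tsum_congr fun k => ?_
    rw [show α * ((k + 1 : ℕ) : ℝ) + β = α * k + (β + α) by push_cast; ring,
      show n + 1 + (k + 1) = n + (k + 1) + 1 by ring, Nat.choose_succ_succ,
      show n + 1 + k = n + (k + 1) by ring]
    push_cast
    ring

end PrabKernel

/-! ### Delay kernels -/

/-- The partial sum of order `N` of the delay series, with every term extended by `0` to the left
of its starting point `n τ`. -/
noncomputable def delayKernel (N : ℕ) (α τ κ δ ρ t : ℝ) : ℝ :=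
  ∑ n ∈ Finset.range N, δ ^ n * prabKernel α κ (α * n + ρ) n (t - n * τ)

section DelayKernel
variable {N : ℕ} {α τ κ δ ρ ν : ℝ}

lemma delayKernel_of_nonpos (hτ : 0 < τ) {t : ℝ} (ht : t ≤ 0) :
    delayKernel N α τ κ δ ρ t = 0 := by
  refine Finset.sum_eq_zero fun n _ => ?_
  have : 0 ≤ n * τ := by positivity
  rw [prabKernel_of_nonpos (by linarith), mul_zero]

lemma measurable_delayKernel (hα : 0 < α) (hρ : 0 < ρ) :
    Measurable (delayKernel N α τ κ δ ρ) := by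
  refine Finset.measurable_fun_sum _ fun n _ => ?_
  have := measurable_prabKernel hα (show 0 < α * n + ρ by positivity) κ n
  fun_prop

lemma abs_delayKernel_le (hα : 0 < α) (hρ : 0 < ρ) (t : ℝ) :
    |delayKernel N α τ κ δ ρ t| ≤ delayKernel N α τ |κ| |δ| ρ t := by
  refine (Finset.abs_sum_le_sum_abs _ _).trans (Finset.sum_le_sum fun n _ => ?_)
  rw [abs_mul, abs_pow]
  exact mul_le_mul_of_nonneg_left (abs_prabKernel_le hα (by positivity) κ n _) (by positivity)

lemma delayKernel_abs_mono (hα : 0 < α) (hρ : 1 ≤ ρ) :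
    Monotone (delayKernel N α τ |κ| |δ| ρ) := by
  intro s t hst
  refine Finset.sum_le_sum fun n _ => ?_
  have h0 : 0 ≤ α * n := by positivity
  exact mul_le_mul_of_nonneg_left (prabKernel_abs_mono hα (by linarith) κ n (by linarith))
    (by positivity)

lemma integrable_powKernel_mul_delayKernel (hα : 0 < α) (hρ : 0 < ρ) (hν : 0 < ν) (u : ℝ) :
    Integrable fun s => powKernel ν (u - s) * delayKernel N α τ κ δ ρ s := by
  simp only [delayKernel, Finset.mul_sum]
  refine integrable_finsetSum _ fun n _ => ?_
  have h := ((integrable_powKernel_mul_prabKernel hα (show 0 < α * n + ρ by positivity) hν κ n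
    (u - n * τ)).comp_sub_right (n * τ)).const_mul (δ ^ n)
  refine h.congr (Eventually.of_forall fun s => ?_)
  simp only [sub_sub_sub_cancel_right]
  ring

lemma integral_powKernel_mul_delayKernel (hα : 0 < α) (hρ : 0 < ρ) (hν : 0 < ν) (u : ℝ) :
    ∫ s, powKernel ν (u - s) * delayKernel N α τ κ δ ρ s = delayKernel N α τ κ δ (ρ + ν) u := by
  have hpos : ∀ n : ℕ, 0 < α * n + ρ := fun n => by positivity
  have e : ∀ (n : ℕ) s, powKernel ν (u - s) * (δ ^ n * prabKernel α κ (α * n + ρ) n (s - n * τ)) =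
      δ ^ n * (powKernel ν (u - n * τ - (s - n * τ)) *
        prabKernel α κ (α * n + ρ) n (s - n * τ)) := fun n s => by
    rw [sub_sub_sub_cancel_right]
    ring
  simp only [delayKernel, Finset.mul_sum, e]
  rw [integral_finsetSum]
  · refine Finset.sum_congr rfl fun n _ => ?_
    rw [integral_const_mul, integral_sub_right_eq_self (fun s => powKernel ν (u - n * τ - s) *
      prabKernel α κ (α * n + ρ) n s), integral_powKernel_mul_prabKernel hα (hpos n) hν, add_assoc]
  · exact fun n _ => ((integrable_powKernel_mul_prabKernel hα (hpos n) hν κ n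
      (u - n * τ)).comp_sub_right (n * τ)).const_mul (δ ^ n)

lemma integral_abs_powKernel_mul_delayKernel_le (hα : 0 < α) (hρ : 0 < ρ) (hν : 0 < ν)
    (h1 : 1 ≤ ρ + ν) {u T : ℝ} (hu : u ≤ T) :
    ∫ s, |powKernel ν (u - s) * delayKernel N α τ κ δ ρ s| ≤
      delayKernel N α τ |κ| |δ| (ρ + ν) T := by
  refine le_trans ?_ (delayKernel_abs_mono hα h1 hu)
  rw [← integral_powKernel_mul_delayKernel hα hρ hν]
  refine integral_mono (integrable_powKernel_mul_delayKernel hα hρ hν u).abs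
    (integrable_powKernel_mul_delayKernel hα hρ hν u) fun s => ?_
  simp only [abs_mul, abs_of_nonneg (powKernel_nonneg hν _)]
  exact mul_le_mul_of_nonneg_left (abs_delayKernel_le hα hρ s) (powKernel_nonneg hν _)

lemma delayKernel_succ {t : ℝ} (ht : t ≤ N * τ) :
    delayKernel (N + 1) α τ κ δ ρ t = delayKernel N α τ κ δ ρ t := by
  rw [delayKernel, Finset.sum_range_succ, prabKernel_of_nonpos (by linarith), mul_zero, add_zero,
    delayKernel]

/-- Sum `prabKernel_zero_eq` for the first term and `prabKernel_succ_eq` for the others; the index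
shift produces the delay. Since `t < N * τ`, the last term of the delayed sum vanishes at `t - τ`.
-/
lemma delayKernel_eq (hα : 0 < α) (hρ : 0 < ρ) {t : ℝ} (ht : t < N * τ) :
    delayKernel N α τ κ δ ρ t = powKernel ρ t + κ * delayKernel N α τ κ δ (ρ + α) t +
      δ * delayKernel N α τ κ δ (ρ + α) (t - τ) := by
  cases N with
  | zero =>
    have : t ≤ 0 := by simpa using ht.le
    simp [delayKernel, powKernel_of_nonpos this]
  | succ N =>
    rw [delayKernel_succ (t := t - τ) (by push_cast at ht; linarith)]
    simp only [delayKernel]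
    rw [Finset.sum_range_succ', Finset.sum_range_succ', mul_add, Finset.mul_sum, Finset.mul_sum]
    have e : ∀ n ∈ Finset.range N, δ ^ (n + 1) * prabKernel α κ (α * ((n + 1 : ℕ) : ℝ) + ρ) (n + 1)
        (t - ((n + 1 : ℕ) : ℝ) * τ) =
        κ * (δ ^ (n + 1) * prabKernel α κ (α * ((n + 1 : ℕ) : ℝ) + (ρ + α)) (n + 1)
          (t - ((n + 1 : ℕ) : ℝ) * τ)) +
        δ * (δ ^ n * prabKernel α κ (α * n + (ρ + α)) n (t - τ - n * τ)) := fun n _ => by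
      rw [prabKernel_succ_eq hα (by positivity)]
      rw [show α * ((n + 1 : ℕ) : ℝ) + ρ = α * n + (ρ + α) by push_cast; ring,
        show t - ((n + 1 : ℕ) : ℝ) * τ = t - τ - n * τ by push_cast; ring,
        show α * ((n + 1 : ℕ) : ℝ) + (ρ + α) = α * n + (ρ + α) + α by push_cast; ring]
      ring
    rw [Finset.sum_congr rfl e, Finset.sum_add_distrib]
    simp only [pow_zero, Nat.cast_zero, mul_zero, zero_add, zero_mul, sub_zero, one_mul]
    rw [prabKernel_zero_eq hα hρ]
    ring

/-- At `t = n * τ` the series contains `0 ^ (α * n + ρ - 1)`, which is `1` if the exponent is zero,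
while the kernel vanishes there. Either such times are avoided, or `1 ≤ ρ` makes the exponent
positive, as `t > 0` excludes `n = 0`. -/
lemma delaySeries_eq_delayKernel (hα : 0 < α) (hτ : 0 < τ) {t : ℝ} (ht : 0 < t)
    (htN : t < N * τ) (h : (∀ n : ℕ, t ≠ n * τ) ∨ 1 ≤ ρ) :
    delaySeries α τ κ δ ρ t = delayKernel N α τ κ δ ρ t := by
  have hsub : Finset.range (⌊t / τ⌋₊ + 1) ⊆ Finset.range N := by
    have : ⌊t / τ⌋₊ < N := (Nat.floor_lt (by positivity)).2 ((div_lt_iff₀ hτ).2 htN)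
    exact Finset.range_subset_range.2 this
  rw [delaySeries, delayKernel, ← Finset.sum_subset hsub]
  · refine Finset.sum_congr rfl fun n hn => ?_
    have hn' : (n : ℝ) ≤ t / τ :=
      (Nat.le_floor_iff (by positivity)).1 (by simpa [Nat.lt_succ_iff] using hn)
    rw [le_div_iff₀ hτ] at hn'
    rcases hn'.lt_or_eq with hlt | heq
    · rw [prabKernel_of_pos (by linarith), mul_assoc]
    · have hρ := h.resolve_left fun h' => h' n heq.symm
      have hn0 : n ≠ 0 := by
        rintro rfl
        simp at heq
        exact ht.ne heq
      have : 0 < α * n := by positivity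
      rw [prabKernel_of_nonpos (by linarith), heq, sub_self, Real.zero_rpow (by linarith)]
      simp
  · intro n _ hn
    have hn' : t / τ < n := (Nat.floor_lt (by positivity)).1 (by
      simpa [Nat.lt_succ_iff, Nat.succ_le_iff] using hn)
    rw [div_lt_iff₀ hτ] at hn'
    rw [prabKernel_of_nonpos (by linarith), mul_zero]

end DelayKernel

/-! ### Associativity of convolution -/

section Convolution
variable {E : Type*} [NormedAddCommGroup E] [NormedSpace ℝ E]

lemma integral_powKernel_one_sub_smul {f : ℝ → E} (hf : ∀ s ≤ 0, f s = 0) {t : ℝ} (ht : 0 ≤ t) :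
    ∫ s, powKernel 1 (t - s) • f s = ∫ s in (0 : ℝ)..t, f s := by
  rw [intervalIntegral.integral_of_le ht, integral_Ioc_eq_integral_Ioo,
    ← integral_indicator measurableSet_Ioo]
  congr 1
  ext s
  by_cases hs : s ∈ Ioo 0 t
  · rw [indicator_of_mem hs, powKernel_one (by linarith [hs.2]), one_smul]
  · rw [indicator_of_notMem hs]
    rcases le_or_gt s 0 with h | h
    · rw [hf s h, smul_zero]
    · rw [powKernel_of_nonpos, zero_smul]
      by_contra! h'
      exact hs ⟨h, by linarith⟩

/-- Associativity of convolution at a point, with its absolute convergence. -/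
lemma convolution_assoc_at [CompleteSpace E] {a b : ℝ → ℝ} {c : ℝ → E} (ha : Measurable a)
    (hb : Measurable b) (hc : Integrable c) {t M : ℝ} (hab : ∀ r, c r ≠ 0 → Integrable fun s => a (t - r - s) * b s)
    (hM : ∀ r, c r ≠ 0 → ∫ s, |a (t - r - s) * b s| ≤ M) :
    Integrable (fun s => a (t - s) • ∫ r, b (s - r) • c r) ∧
      ∫ s, a (t - s) • ∫ r, b (s - r) • c r = ∫ r, (∫ s, a (t - r - s) * b s) • c r := by
  set f : ℝ → ℝ → E := fun s r => (a (t - s) * b (s - r)) • c r with hf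
  have hmeas : AEStronglyMeasurable (Function.uncurry f) (volume.prod volume) := by
    refine AEStronglyMeasurable.smul ?_ hc.1.comp_snd
    refine Measurable.aestronglyMeasurable ?_
    fun_prop
  have hshift : ∀ r s, a (t - s) * b (s - r) = a (t - r - (s - r)) * b (s - r) := fun r s => by
    rw [sub_sub_sub_cancel_right]
  have hnorm : ∀ r, ∫ s, ‖f s r‖ = (∫ s, |a (t - r - s) * b s|) * ‖c r‖ := fun r => by
    simp only [hf, norm_smul, Real.norm_eq_abs, hshift]
    rw [integral_mul_const, integral_sub_right_eq_self (fun s => |a (t - r - s) * b s|)]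
  have hint : Integrable (Function.uncurry f) (volume.prod volume) := by
    refine (integrable_prod_iff' hmeas).2 ⟨Eventually.of_forall fun r => ?_, ?_⟩
    · by_cases hr : c r = 0
      · simp [hf, hr]
      · simp only [Function.uncurry, hf, hshift]
        exact ((hab r hr).comp_sub_right r).smul_const _
    · refine Integrable.mono' (hc.norm.const_mul M) hmeas.norm.prod_swap.integral_prod_right'
        (Eventually.of_forall fun r => ?_)
      simp only [Function.uncurry]
      rw [hnorm, norm_mul, norm_norm, Real.norm_of_nonneg (integral_nonneg fun s => abs_nonneg _)]
      by_cases hr : c r = 0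
      · simp [hr]
      · exact mul_le_mul_of_nonneg_right (hM r hr) (norm_nonneg _)
  have e1 : ∀ s, ∫ r, f s r = a (t - s) • ∫ r, b (s - r) • c r := fun s => by
    simp only [hf, mul_smul]
    rw [integral_smul]
  have e2 : ∀ r, ∫ s, f s r = (∫ s, a (t - r - s) * b s) • c r := fun r => by
    simp only [hf, hshift]
    rw [integral_smul_const, integral_sub_right_eq_self (fun s => a (t - r - s) * b s)]
  have h1 := hint.integral_prod_left
  simp only [Function.uncurry, e1] at h1
  refine ⟨h1, ?_⟩
  have h2 := integral_integral_swap hint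
  simp only [e1, e2] at h2
  exact h2

end Convolution

/-! ### Absolutely continuous functions as integrals -/

section AbsolutelyContinuous
variable {E : Type*} [NormedAddCommGroup E] [NormedSpace ℝ E]

lemma AbsolutelyContinuousOnInterval.of_dist_le {X Y : Type*} [PseudoMetricSpace X]
    [PseudoMetricSpace Y] {f : ℝ → X} {g : ℝ → Y} {a b : ℝ}
    (hf : AbsolutelyContinuousOnInterval f a b)
    (h : ∀ x ∈ uIcc a b, ∀ y ∈ uIcc a b, dist (g x) (g y) ≤ dist (f x) (f y)) :
    AbsolutelyContinuousOnInterval g a b := by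
  rw [absolutelyContinuousOnInterval_iff] at hf ⊢
  intro ε hε
  obtain ⟨δ, hδ, H⟩ := hf ε hε
  refine ⟨δ, hδ, fun I hI hlen => (Finset.sum_le_sum fun i hi => ?_).trans_lt (H I hI hlen)⟩
  exact h _ (hI.1 i hi).1 _ (hI.1 i hi).2

/-- Increments of `f` are bounded by those of the real primitive of `‖g‖`, which is absolutely
continuous. -/
lemma absolutelyContinuousOnInterval_of_eq_integral {f g : ℝ → E} {a b : ℝ} (hab : a ≤ b)
    (hg : IntervalIntegrable g volume a b) (hf : ∀ x ∈ Icc a b, f x = f a + ∫ s in a..x, g s) :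
    AbsolutelyContinuousOnInterval f a b := by
  refine (hg.norm.absolutelyContinuousOnInterval_intervalIntegral
    (c := a) (by simp)).of_dist_le fun x hx y hy => ?_
  have hx' := hx
  have hy' := hy
  rw [uIcc_of_le hab] at hx' hy'
  have hi : ∀ z ∈ uIcc a b, IntervalIntegrable g volume a z := fun z hz =>
    hg.mono_set (uIcc_subset_uIcc (by simp) hz)
  rw [hf x hx', hf y hy', dist_add_left, dist_eq_norm, Real.dist_eq,
    intervalIntegral.integral_interval_sub_left (hi x hx) (hi y hy),
    intervalIntegral.integral_interval_sub_left (hi x hx).norm (hi y hy).norm]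
  exact intervalIntegral.norm_integral_le_abs_integral_norm

/-- The real fundamental theorem is applied to the real and imaginary parts. -/
lemma AbsolutelyContinuousOnInterval.exists_eq_integral {𝕜 : Type*} [RCLike 𝕜] {f : ℝ → 𝕜}
    {a b : ℝ} (hf : AbsolutelyContinuousOnInterval f a b) :
    ∃ g : ℝ → 𝕜, IntervalIntegrable g volume a b ∧
      ∀ x ∈ uIcc a b, f x = f a + ∫ s in a..x, g s := by
  have hre : AbsolutelyContinuousOnInterval (fun x => RCLike.re (f x)) a b :=
    hf.of_dist_le fun x _ y _ => by
      rw [Real.dist_eq, dist_eq_norm, ← map_sub]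
      exact RCLike.abs_re_le_norm _
  have him : AbsolutelyContinuousOnInterval (fun x => RCLike.im (f x)) a b :=
    hf.of_dist_le fun x _ y _ => by
      rw [Real.dist_eq, dist_eq_norm, ← map_sub]
      exact RCLike.abs_im_le_norm _
  have h1 := hre.intervalIntegrable_deriv
  have h2 := him.intervalIntegrable_deriv
  have hof : ∀ {h : ℝ → ℝ} {c d : ℝ}, IntervalIntegrable h volume c d →
      IntervalIntegrable (fun s => (h s : 𝕜)) volume c d := fun hh => ⟨hh.1.ofReal, hh.2.ofReal⟩
  refine ⟨fun s => ((deriv (fun x => RCLike.re (f x)) s : ℝ) : 𝕜) +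
    ((deriv (fun x => RCLike.im (f x)) s : ℝ) : 𝕜) * RCLike.I, ?_, fun x hx => ?_⟩
  · exact (hof h1).add ((hof h2).mul_const _)
  · have hs : uIcc a x ⊆ uIcc a b := uIcc_subset_uIcc (by simp) hx
    rw [intervalIntegral.integral_add, intervalIntegral.integral_mul_const,
      RCLike.intervalIntegral_ofReal, RCLike.intervalIntegral_ofReal,
      (hre.mono hs).integral_deriv_eq_sub, (him.mono hs).integral_deriv_eq_sub]
    · rw [RCLike.ofReal_sub, RCLike.ofReal_sub]
      linear_combination RCLike.re_add_im (f a) - RCLike.re_add_im (f x)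
    · exact (hof h1).mono_set hs
    · exact ((hof h2).mul_const _).mono_set hs

end AbsolutelyContinuous

/-! ### Convolutions with the density of the history -/

section History
variable {𝕜 : Type*} [RCLike 𝕜] {N : ℕ} {α τ κ δ ρ ν : ℝ} {c : ℝ → 𝕜}

/-- The derivative of the history, moved to `(0, τ]` and extended by `0`. -/
lemma exists_history_density (hτ : 0 < τ) {ψ : ℝ → 𝕜}
    (hψ : AbsolutelyContinuousOnInterval ψ (-τ) 0) :
    ∃ c : ℝ → 𝕜, Integrable c ∧ (∀ r ≤ 0, c r = 0) ∧
      ∀ s, 0 ≤ s → ψ (min s τ - τ) = ψ (-τ) + ∫ r in (0 : ℝ)..s, c r := by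
  obtain ⟨g, hg, h⟩ := hψ.exists_eq_integral
  have hg' : IntervalIntegrable (fun r => g (r - τ)) volume 0 τ := by
    simpa using hg.comp_sub_right τ
  refine ⟨(Ioc 0 τ).indicator fun r => g (r - τ), ?_, fun r hr => ?_, fun s hs => ?_⟩
  · exact (integrable_indicator_iff measurableSet_Ioc).2
      ((intervalIntegrable_iff_integrableOn_Ioc_of_le hτ.le).1 hg')
  · exact indicator_of_notMem (fun h => h.1.not_ge hr) _
  · have hm : 0 ≤ min s τ := le_min hs hτ.le
    rw [intervalIntegral.integral_of_le hs, setIntegral_indicator measurableSet_Ioc,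
      Ioc_inter_Ioc, max_self, ← intervalIntegral.integral_of_le hm,
      intervalIntegral.integral_comp_sub_right (fun r => g r), zero_sub]
    refine h _ ?_
    rw [uIcc_of_le (by linarith)]
    exact ⟨by linarith, by linarith [min_le_right s τ]⟩

lemma integrable_delayKernel_mul_powKernel_one (hα : 0 < α) (hρ : 0 < ρ) (u : ℝ) :
    Integrable fun s => delayKernel N α τ κ δ ρ (u - s) * powKernel 1 s := by
  have h := (integrable_powKernel_mul_delayKernel (N := N) (τ := τ) (κ := κ) (δ := δ) hα hρ
    one_pos u).comp_sub_left u
  refine h.congr (Eventually.of_forall fun s => ?_)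
  simp only [sub_sub_cancel]
  ring

/-- Commutativity of convolution; `F` is the identity for the value and `abs` for the bound. -/
lemma integral_comp_delayKernel_mul_powKernel_one (F : ℝ → ℝ) (u : ℝ) :
    ∫ s, F (delayKernel N α τ κ δ ρ (u - s) * powKernel 1 s) =
      ∫ s, F (powKernel 1 (u - s) * delayKernel N α τ κ δ ρ s) := by
  rw [← integral_sub_left_eq_self _ volume u]
  simp only [sub_sub_cancel, mul_comm]

lemma integral_delayKernel_mul_powKernel_one (hα : 0 < α) (hρ : 0 < ρ) (u : ℝ) :
    ∫ s, delayKernel N α τ κ δ ρ (u - s) * powKernel 1 s = delayKernel N α τ κ δ (ρ + 1) u :=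
  (integral_comp_delayKernel_mul_powKernel_one id u).trans
    (integral_powKernel_mul_delayKernel hα hρ one_pos u)

/-- As `c` lives on `r > 0`, kernels are evaluated at `t - r ≤ t`. For `1 ≤ ρ + ν` the monotone
majorant at `t` bounds them uniformly, so the identity holds at every `t` although `c` is only
integrable. -/
lemma powKernel_convolution_delayKernel_convolution (hα : 0 < α) (hρ : 0 < ρ) (hν : 0 < ν)
    (h1 : 1 ≤ ρ + ν) (hc : Integrable c) (hc0 : ∀ r ≤ 0, c r = 0) (t : ℝ) :
    Integrable (fun s => powKernel ν (t - s) • ∫ r, delayKernel N α τ κ δ ρ (s - r) • c r) ∧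
      ∫ s, powKernel ν (t - s) • ∫ r, delayKernel N α τ κ δ ρ (s - r) • c r =
        ∫ r, delayKernel N α τ κ δ (ρ + ν) (t - r) • c r := by
  have h := convolution_assoc_at (measurable_powKernel ν)
    (measurable_delayKernel (N := N) (τ := τ) (κ := κ) (δ := δ) hα hρ) hc
    (t := t) (fun r _ => integrable_powKernel_mul_delayKernel hα hρ hν (t - r))
    (M := delayKernel N α τ |κ| |δ| (ρ + ν) t) fun r hr =>
      integral_abs_powKernel_mul_delayKernel_le hα hρ hν h1 (by
        have : 0 < r := lt_of_not_ge fun h => hr (hc0 r h)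
        linarith)
  refine ⟨h.1, h.2.trans ?_⟩
  simp only [integral_powKernel_mul_delayKernel hα hρ hν]

lemma delayKernel_convolution_powKernel_convolution (hα : 0 < α) (hρ : 0 < ρ)
    (hc : Integrable c) (hc0 : ∀ r ≤ 0, c r = 0) (t : ℝ) :
    Integrable (fun s => delayKernel N α τ κ δ ρ (t - s) • ∫ r, powKernel 1 (s - r) • c r) ∧
      ∫ s, delayKernel N α τ κ δ ρ (t - s) • ∫ r, powKernel 1 (s - r) • c r =
        ∫ r, delayKernel N α τ κ δ (ρ + 1) (t - r) • c r := by
  have h := convolution_assoc_at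
    (measurable_delayKernel (N := N) (τ := τ) (κ := κ) (δ := δ) hα hρ) (measurable_powKernel 1) hc
    (t := t) (fun r _ => integrable_delayKernel_mul_powKernel_one hα hρ (t - r))
    (M := delayKernel N α τ |κ| |δ| (ρ + 1) t) fun r hr => by
      rw [integral_comp_delayKernel_mul_powKernel_one abs]
      refine integral_abs_powKernel_mul_delayKernel_le hα hρ one_pos (by linarith) ?_
      have : 0 < r := lt_of_not_ge fun h => hr (hc0 r h)
      linarith
  refine ⟨h.1, h.2.trans ?_⟩
  simp only [integral_delayKernel_mul_powKernel_one hα hρ]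

lemma delayKernel_convolution_of_nonpos (hτ : 0 < τ) (hc0 : ∀ r ≤ 0, c r = 0) {t : ℝ}
    (ht : t ≤ 0) : ∫ r, delayKernel N α τ κ δ ρ (t - r) • c r = 0 := by
  rw [← integral_zero ℝ 𝕜]
  congr 1
  ext r
  rcases le_or_gt r 0 with hr | hr
  · rw [hc0 r hr, smul_zero]
  · rw [delayKernel_of_nonpos hτ (by linarith), zero_smul]

lemma integrable_delayKernel_smul (hα : 0 < α) (hρ : 1 ≤ ρ) (hc : Integrable c)
    (hc0 : ∀ r ≤ 0, c r = 0) (t : ℝ) :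
    Integrable fun r => delayKernel N α τ κ δ ρ (t - r) • c r := by
  have hρ0 : 0 < ρ := by linarith
  refine (hc.norm.const_mul (delayKernel N α τ |κ| |δ| ρ t)).mono' ?_
    (Eventually.of_forall fun r => ?_)
  · have := measurable_delayKernel (N := N) (τ := τ) (κ := κ) (δ := δ) hα hρ0
    exact (show Measurable fun r => delayKernel N α τ κ δ ρ (t - r) by
      fun_prop).aestronglyMeasurable.smul hc.1
  · rcases le_or_gt r 0 with hr | hr
    · simp [hc0 r hr]
    · rw [norm_smul, Real.norm_eq_abs]
      exact mul_le_mul_of_nonneg_right ((abs_delayKernel_le hα hρ0 _).trans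
        (delayKernel_abs_mono hα hρ (by linarith))) (norm_nonneg _)

lemma integrable_powKernel_one_smul (hc : Integrable c) (t : ℝ) :
    Integrable fun r => powKernel 1 (t - r) • c r := by
  refine hc.norm.mono' ?_ (Eventually.of_forall fun r => ?_)
  · have := measurable_powKernel 1
    exact (show Measurable fun r => powKernel 1 (t - r) by
      fun_prop).aestronglyMeasurable.smul hc.1
  · rw [norm_smul]
    refine mul_le_of_le_one_left (norm_nonneg _) ?_
    rcases le_or_gt (t - r) 0 with h | h
    · simp [powKernel_of_nonpos h]
    · simp [powKernel_one h]

lemma delayKernel_one_convolution (hα : 0 < α) (hc : Integrable c) (hc0 : ∀ r ≤ 0, c r = 0)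
    {t : ℝ} (ht : 0 ≤ t) (htN : t < N * τ) :
    ∫ r, delayKernel N α τ κ δ 1 (t - r) • c r = (∫ r in (0 : ℝ)..t, c r) +
      κ • (∫ r, delayKernel N α τ κ δ (α + 1) (t - r) • c r) +
      δ • ∫ r, delayKernel N α τ κ δ (α + 1) (t - τ - r) • c r := by
  have h1 := integrable_powKernel_one_smul hc t
  have h2 := fun t => integrable_delayKernel_smul (N := N) (τ := τ) (κ := κ) (δ := δ) hα
    (show 1 ≤ α + 1 by linarith) hc hc0 t
  rw [← integral_powKernel_one_sub_smul hc0 ht, ← integral_smul, ← integral_smul,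
    ← integral_add h1 ((h2 t).fun_smul κ),
    ← integral_add (h1.fun_add ((h2 t).fun_smul κ)) ((h2 (t - τ)).fun_smul δ)]
  congr 1
  ext r
  rcases le_or_gt r 0 with hr | hr
  · simp [hc0 r hr]
  · rw [delayKernel_eq hα one_pos (by linarith), add_comm 1 α, sub_right_comm t r τ]
    simp only [add_smul, mul_smul]

end History

/-! ### Integral representation of the coefficient function -/

section Representation
variable {𝕜 : Type*} [RCLike 𝕜] {N : ℕ} {α τ κ δ : ℝ} {c : ℝ → 𝕜} {c₀ : 𝕜} {ψ : ℝ → 𝕜}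

lemma convol_delaySeries_eq (hα : 0 < α) (hτ : 0 < τ) (hc : Integrable c)
    (hc0 : ∀ r ≤ 0, c r = 0)
    (hψ : ∀ s, 0 ≤ s → ψ (min s τ - τ) = ψ (-τ) + ∫ r in (0 : ℝ)..s, c r)
    {t : ℝ} (ht : 0 < t) (htN : t < N * τ) :
    convol (fun r => δ * delaySeries α τ κ δ α r) (fun r => pastCutoff (r - τ) • ψ (r - τ)) t =
      δ • (delayKernel N α τ κ δ (α + 1) t • ψ (-τ) +
        (∫ r, delayKernel N α τ κ δ (α + 1) (t - r) • c r) -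
        delayKernel N α τ κ δ (α + 1) (t - τ) • ψ 0) := by
  set K := delayKernel N α τ κ δ α with hK
  -- `H` is the shifted, cut-off history: the first two terms follow `ψ` up to time `τ` and then
  -- stay at `ψ 0`, which the last term removes. Each term involves `powKernel 1`, so convolution
  -- with `K` raises the index by one.
  set H : ℝ → 𝕜 := fun s => powKernel 1 s • ψ (-τ) + (∫ r, powKernel 1 (s - r) • c r) -
    powKernel 1 (s - τ) • ψ 0 with hH
  have hH0 : ∀ s ≤ 0, H s = 0 := fun s hs => by
    have : ∫ r, powKernel 1 (s - r) • c r = 0 := by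
      rw [← integral_zero ℝ 𝕜]
      congr 1
      ext r
      rcases le_or_gt r 0 with hr | hr
      · rw [hc0 r hr, smul_zero]
      · rw [powKernel_of_nonpos (by linarith), zero_smul]
    simp only [hH]
    rw [this, powKernel_of_nonpos hs, powKernel_of_nonpos (by linarith)]
    simp
  have hHpos : ∀ s, 0 < s → s ≠ τ → pastCutoff (s - τ) • ψ (s - τ) = H s := fun s hs hsτ => by
    have h := hψ s hs.le
    simp only [hH]
    rw [integral_powKernel_one_sub_smul hc0 hs.le, powKernel_one hs, one_smul, ← h]
    rcases hsτ.lt_or_gt with h' | h'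
    · rw [powKernel_of_nonpos (by linarith), min_eq_left h'.le, pastCutoff, if_neg (by linarith)]
      simp
    · rw [powKernel_one (by linarith), min_eq_right h'.le, pastCutoff, if_pos (by linarith)]
      simp
  have e1 : convol (fun r => δ * delaySeries α τ κ δ α r)
      (fun r => pastCutoff (r - τ) • ψ (r - τ)) t =
      ∫ r in (0 : ℝ)..t, δ • (K r • H (t - r)) := by
    refine intervalIntegral.integral_congr_ae ?_
    -- The null set discarded: the lattice points, where series and kernel may differ, and `r = t`,
    -- `r = t - τ`, where `H` may differ from the cut-off history.
    have hcount : ∀ᵐ r : ℝ, r ∉ range fun n : ℕ => (n : ℝ) * τ :=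
      (countable_range _).ae_notMem volume
    filter_upwards [hcount, Measure.ae_ne volume t, Measure.ae_ne volume (t - τ)] with r h1 h2 h3 hr
    rw [uIoc_of_le ht.le] at hr
    have hrt : 0 < t - r := sub_pos.2 (lt_of_le_of_ne hr.2 h2)
    rw [delaySeries_eq_delayKernel (N := N) hα hτ hr.1 (by linarith)
      (Or.inl fun n hn => h1 ⟨n, hn.symm⟩), mul_smul, hHpos _ hrt fun h => h3 (by linarith)]
  have e2 : ∫ r in (0 : ℝ)..t, K r • H (t - r) = ∫ s, K (t - s) • H s := by
    rw [intervalIntegral.integral_of_le ht.le, setIntegral_eq_integral_of_forall_compl_eq_zero,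
      ← integral_sub_left_eq_self (fun s => K (t - s) • H s) volume t]
    · simp only [sub_sub_cancel]
    · intro r hr
      rcases le_or_gt r 0 with h | h
      · rw [hK, delayKernel_of_nonpos hτ h, zero_smul]
      · rw [hH0, smul_zero]
        by_contra! h'
        exact hr ⟨h, by linarith⟩
  have i1 : Integrable fun s => (K (t - s) * powKernel 1 s) • ψ (-τ) :=
    (integrable_delayKernel_mul_powKernel_one hα hα t).smul_const _
  have i2 := delayKernel_convolution_powKernel_convolution (N := N) (τ := τ) (κ := κ) (δ := δ)
    hα hα hc hc0 t
  have e3 : ∀ s, K (t - s) * powKernel 1 (s - τ) = K (t - τ - (s - τ)) * powKernel 1 (s - τ) :=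
    fun s => by rw [sub_sub_sub_cancel_right]
  have i3 : Integrable fun s => (K (t - s) * powKernel 1 (s - τ)) • ψ 0 := by
    simp only [e3]
    exact ((integrable_delayKernel_mul_powKernel_one hα hα (t - τ)).comp_sub_right τ).smul_const _
  rw [e1, intervalIntegral.integral_smul, e2]
  congr 1
  have e4 : ∀ s, K (t - s) • H s = (K (t - s) * powKernel 1 s) • ψ (-τ) +
      K (t - s) • (∫ r, powKernel 1 (s - r) • c r) - (K (t - s) * powKernel 1 (s - τ)) • ψ 0 :=
    fun s => by simp only [hH, smul_sub, smul_add, mul_smul]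
  simp only [e4]
  rw [integral_sub (i1.fun_add i2.1) i3, integral_add i1 i2.1, i2.2, integral_smul_const,
    integral_smul_const]
  simp only [e3]
  rw [integral_sub_right_eq_self (fun s => K (t - τ - s) * powKernel 1 s),
    integral_delayKernel_mul_powKernel_one hα hα, integral_delayKernel_mul_powKernel_one hα hα]

/-- Expanding the kernel of index `1` in front of `ψ 0` by `delayKernel_eq` yields a term at `t -
τ`, which cancels the one left by the cut-off in the convolution. -/
lemma delayCoeff_eq_delayKernel (hα : 0 < α) (hτ : 0 < τ) (hc : Integrable c)
    (hc0 : ∀ r ≤ 0, c r = 0)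
    (hψ : ∀ s, 0 ≤ s → ψ (min s τ - τ) = ψ (-τ) + ∫ r in (0 : ℝ)..s, c r)
    {t : ℝ} (ht : 0 ≤ t) (htN : t < N * τ) :
    delayCoeff α τ κ δ c₀ ψ t = ψ 0 +
      (delayKernel N α τ κ δ (α + 1) t • (κ • ψ 0 + δ • ψ (-τ) + c₀) +
        δ • ∫ r, delayKernel N α τ κ δ (α + 1) (t - r) • c r) := by
  rcases ht.eq_or_lt with rfl | ht
  · rw [delayCoeff, if_pos le_rfl, delayKernel_of_nonpos hτ le_rfl,
      delayKernel_convolution_of_nonpos hτ hc0 le_rfl]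
    simp
  · rw [delayCoeff, if_neg ht.not_ge, convol_delaySeries_eq hα hτ hc hc0 hψ ht htN,
      delaySeries_eq_delayKernel hα hτ ht htN (Or.inr le_rfl),
      delaySeries_eq_delayKernel hα hτ ht htN (Or.inr (by linarith)),
      delayKernel_eq hα one_pos htN, powKernel_one ht, add_comm 1 α]
    module

/-- Up to any time `T`, the coefficient function is the integral of a function whose fractional
integral of order `1 - α` is the right-hand side of the delay equation. -/
theorem delayCoeff_representation (hα : 0 < α) (hτ : 0 < τ)
    (hψ : AbsolutelyContinuousOnInterval ψ (-τ) 0) (T : ℝ) :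
    ∃ G : ℝ → 𝕜,
      (∀ t, 0 ≤ t → t ≤ T → IntervalIntegrable G volume 0 t ∧
        delayCoeff α τ κ δ c₀ ψ t = ψ 0 + ∫ s in (0 : ℝ)..t, G s) ∧
      (α = 1 → ∀ t, 0 < t → t ≤ T → G t = κ • delayCoeff α τ κ δ c₀ ψ t +
        δ • delayCoeff α τ κ δ c₀ ψ (t - τ) + c₀) ∧
      (α < 1 → ∀ t, 0 < t → t ≤ T →
        IntervalIntegrable (fun s => (t - s) ^ (-α) • G s) volume 0 t ∧
        (Real.Gamma (1 - α))⁻¹ • (∫ s in (0 : ℝ)..t, (t - s) ^ (-α) • G s) =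
          κ • delayCoeff α τ κ δ c₀ ψ t + δ • delayCoeff α τ κ δ c₀ ψ (t - τ) + c₀) := by
  obtain ⟨c, hc, hc0, hcψ⟩ := exists_history_density hτ hψ
  -- With `T < N * τ`, one fixed finite sum serves all times up to `T`.
  obtain ⟨N, hN⟩ := exists_nat_gt (T / τ)
  rw [div_lt_iff₀ hτ] at hN
  set C : 𝕜 := κ • ψ 0 + δ • ψ (-τ) + c₀ with hC
  set K := delayKernel N α τ κ δ with hK
  set A := delayCoeff α τ κ δ c₀ ψ with hA
  -- The formal derivative of the formula in `delayCoeff_eq_delayKernel`: the kernel index drops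
  -- from `α + 1` to `α`.
  set G : ℝ → 𝕜 := fun s => K α s • C + δ • ∫ r, K α (s - r) • c r with hG
  have hGconv : ∀ ν, 0 < ν → 1 ≤ α + ν → ∀ t,
      Integrable (fun s => powKernel ν (t - s) • G s) ∧
      ∫ s, powKernel ν (t - s) • G s = K (α + ν) t • C + δ • ∫ r, K (α + ν) (t - r) • c r := by
    intro ν hν h1 t
    have i1 := (integrable_powKernel_mul_delayKernel (N := N) (τ := τ) (κ := κ) (δ := δ) hα hα hν
      t).smul_const C
    have i2 := powKernel_convolution_delayKernel_convolution (N := N) (τ := τ) (κ := κ) (δ := δ)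
      hα hα hν h1 hc hc0 t
    have e : ∀ s, powKernel ν (t - s) • G s = (powKernel ν (t - s) * K α s) • C +
        δ • (powKernel ν (t - s) • ∫ r, K α (s - r) • c r) := fun s => by
      simp only [hG, smul_add, mul_smul]
      rw [smul_comm δ]
    simp only [e]
    refine ⟨i1.fun_add (i2.1.fun_smul δ), ?_⟩
    rw [integral_add i1 (i2.1.fun_smul δ), integral_smul, i2.2, integral_smul_const,
      integral_powKernel_mul_delayKernel hα hα hν]
  have hG0 : ∀ s ≤ 0, G s = 0 := fun s hs => by
    simp only [hG, hK]
    rw [delayKernel_of_nonpos hτ hs, delayKernel_convolution_of_nonpos hτ hc0 hs]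
    simp
  have hJ : ∀ t, 0 ≤ t → t ≤ T → A t = ψ 0 +
      (K (α + 1) t • C + δ • ∫ r, K (α + 1) (t - r) • c r) := fun t ht htT =>
    delayCoeff_eq_delayKernel hα hτ hc hc0 hcψ ht (by linarith)
  have hrhs : ∀ t, 0 < t → t ≤ T → K 1 t • C + δ • (∫ r, K 1 (t - r) • c r) =
      κ • A t + δ • A (t - τ) + c₀ := by
    intro t ht htT
    have hψt := hcψ t ht.le
    rw [hJ t ht.le htT]
    simp only [hK]
    rw [delayKernel_one_convolution hα hc hc0 ht.le (by linarith),
      delayKernel_eq hα one_pos (by linarith), powKernel_one ht, add_comm 1 α]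
    -- For `t ≤ τ` the delayed kernels vanish and ψ(-τ) + ∫ c is the history at `t - τ`. For `t ≥ τ`
    -- that sum is already `ψ 0`, and with the delayed kernels it makes up `A (t - τ)`.
    rcases le_total t τ with h | h
    · rw [delayKernel_of_nonpos hτ (show t - τ ≤ 0 by linarith),
        delayKernel_convolution_of_nonpos hτ hc0 (show t - τ ≤ 0 by linarith), hA, delayCoeff,
        if_pos (by linarith)]
      rw [min_eq_left h] at hψt
      rw [hψt]
      simp only [hC]
      module
    · rw [hJ (t - τ) (by linarith) (by linarith)]
      rw [min_eq_right h, sub_self] at hψt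
      have : ∫ r in (0 : ℝ)..t, c r = ψ 0 - ψ (-τ) := by rw [hψt]; ring
      rw [this]
      simp only [hC, hK]
      module
  have hrestrict : ∀ ν t, ∀ s ∈ Ioo 0 t,
      powKernel ν (t - s) • G s = (Real.Gamma ν)⁻¹ • ((t - s) ^ (ν - 1) • G s) := by
    intro ν t s hs
    rw [powKernel_of_pos (by linarith [hs.2]), smul_smul, div_eq_inv_mul]
  refine ⟨G, fun t ht htT => ⟨?_, ?_⟩, fun h t ht htT => ?_, fun h t ht htT => ⟨?_, ?_⟩⟩
  · rw [intervalIntegrable_iff_integrableOn_Ioo_of_le ht]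
    refine (hGconv 1 one_pos (by linarith) t).1.integrableOn.congr_fun (fun s hs => ?_)
      measurableSet_Ioo
    simp only
    rw [powKernel_one (by linarith [hs.2]), one_smul]
  · rw [hJ t ht htT, ← integral_powKernel_one_sub_smul hG0 ht,
      (hGconv 1 one_pos (by linarith) t).2]
  · rw [← hrhs t ht htT]
    simp only [hG, h]
  · rw [intervalIntegrable_iff_integrableOn_Ioo_of_le ht.le]
    have hΓ := Real.Gamma_pos_of_pos (show 0 < 1 - α by linarith)
    refine ((hGconv (1 - α) (by linarith) (by linarith) t).1.fun_smul
      (Real.Gamma (1 - α))).integrableOn.congr_fun (fun s hs => ?_) measurableSet_Ioo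
    simp only
    rw [hrestrict _ t s hs, smul_inv_smul₀ hΓ.ne']
    ring_nf
  · rw [← hrhs t ht htT]
    have h2 := (hGconv (1 - α) (by linarith) (by linarith) t).2
    rw [add_sub_cancel] at h2
    rw [← h2, ← intervalIntegral.integral_smul, intervalIntegral.integral_of_le ht.le,
      integral_Ioc_eq_integral_Ioo, ← setIntegral_eq_integral_of_forall_compl_eq_zero (s := Ioo 0 t)
        (f := fun s => powKernel (1 - α) (t - s) • G s)]
    · refine setIntegral_congr_fun measurableSet_Ioo fun s hs => ?_
      rw [hrestrict _ t s hs]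
      ring_nf
    · intro s hs
      rcases le_or_gt s 0 with h | h
      · rw [hG0 s h, smul_zero]
      · rw [powKernel_of_nonpos, zero_smul]
        by_contra! h'
        exact hs ⟨h, by linarith⟩

end Representation

/-! ### Linearity of the Caputo derivative -/

section CaputoDerivative
variable {𝕜 : Type*} [RCLike 𝕜] {α t : ℝ}

lemma HasCaputoDeriv.mul_const {φ : ℝ → 𝕜} {v : 𝕜} (h : HasCaputoDeriv α φ t v) (p : 𝕜) :
    HasCaputoDeriv α (fun s => φ s * p) t (v * p) := by
  unfold HasCaputoDeriv at h ⊢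
  split_ifs at h ⊢ with hα
  · exact HasDerivAt.mul_const h p
  · simp only [deriv_mul_const_field, ← smul_mul_assoc]
    refine ⟨h.1.mul_const p, ?_⟩
    rw [intervalIntegral.integral_mul_const, ← smul_mul_assoc, h.2]

/-- Absolute continuity gives differentiability almost everywhere, without which `deriv` need not be
additive under the integral. -/
lemma HasCaputoDeriv.add {φ χ : ℝ → 𝕜} {v w : 𝕜} (hφ : HasCaputoDeriv α φ t v)
    (hχ : HasCaputoDeriv α χ t w) (hφa : AbsolutelyContinuousOnInterval φ 0 t)
    (hχa : AbsolutelyContinuousOnInterval χ 0 t) :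
    HasCaputoDeriv α (fun s => φ s + χ s) t (v + w) := by
  unfold HasCaputoDeriv at hφ hχ ⊢
  split_ifs at hφ hχ ⊢ with hα
  · exact HasDerivAt.add hφ hχ
  · have hae : ∀ᵐ s, s ∈ uIoc 0 t → (t - s) ^ (-α) • deriv φ s + (t - s) ^ (-α) • deriv χ s =
        (t - s) ^ (-α) • deriv (fun s => φ s + χ s) s := by
      filter_upwards [hφa.boundedVariationOn.ae_differentiableAt_of_mem_uIcc,
        hχa.boundedVariationOn.ae_differentiableAt_of_mem_uIcc] with s h1 h2 hs
      have hs' := uIoc_subset_uIcc hs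
      rw [deriv_fun_add (h1 hs') (h2 hs'), smul_add]
    refine ⟨(hφ.1.add hχ.1).congr_ae ((ae_restrict_iff' measurableSet_uIoc).2 hae), ?_⟩
    rw [← intervalIntegral.integral_congr_ae hae, intervalIntegral.integral_add hφ.1 hχ.1,
      smul_add, hφ.2, hχ.2]

end CaputoDerivative

/-! ### The scalar delay equation -/

section DelayCoeff
variable {𝕜 : Type*} [RCLike 𝕜] {α τ κ δ : ℝ} {c₀ : 𝕜} {ψ : ℝ → 𝕜}

lemma delayCoeff_of_nonpos {t : ℝ} (ht : t ≤ 0) : delayCoeff α τ κ δ c₀ ψ t = ψ t := if_pos ht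

/-- The densities of the history and of the solution are glued at `0`; no jump arises, as the
representation starts from `ψ 0`. -/
lemma absolutelyContinuousOnInterval_delayCoeff (hα : 0 < α) (hτ : 0 < τ)
    (hψ : AbsolutelyContinuousOnInterval ψ (-τ) 0) {T : ℝ} (hT : 0 < T) :
    AbsolutelyContinuousOnInterval (delayCoeff α τ κ δ c₀ ψ) (-τ) T := by
  obtain ⟨g, hg, hgψ⟩ := hψ.exists_eq_integral
  obtain ⟨G, hG, -⟩ := delayCoeff_representation (κ := κ) (δ := δ) (c₀ := c₀) hα hτ hψ T
  set h : ℝ → 𝕜 := fun s => if s ≤ 0 then g s else G s with hh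
  have hleft : ∀ x ∈ Icc (-τ) 0, ∀ s ∈ uIoc (-τ) x, g s = h s := fun x hx s hs => by
    rw [uIoc_of_le hx.1] at hs
    exact (if_pos (hs.2.trans hx.2)).symm
  have hright : ∀ x, 0 ≤ x → ∀ s ∈ uIoc 0 x, G s = h s := fun x hx s hs => by
    rw [uIoc_of_le hx] at hs
    exact (if_neg hs.1.not_ge).symm
  have i1 : IntervalIntegrable h volume (-τ) 0 :=
    hg.congr (hleft 0 ⟨by linarith, le_rfl⟩)
  have i2 : ∀ x, 0 ≤ x → x ≤ T → IntervalIntegrable h volume 0 x := fun x hx hxT =>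
    (hG x hx hxT).1.congr (hright x hx)
  refine absolutelyContinuousOnInterval_of_eq_integral (by linarith) (i1.trans (i2 T hT.le le_rfl))
    fun x hx => ?_
  have hψx : ∀ x ∈ Icc (-τ) 0, ψ x = ψ (-τ) + ∫ s in (-τ)..x, h s := fun x hx => by
    rw [hgψ x (by rwa [uIcc_of_le (by linarith)]),
      intervalIntegral.integral_congr_ae (Eventually.of_forall (hleft x hx))]
  rw [delayCoeff_of_nonpos (t := -τ) (by linarith)]
  rcases le_total x 0 with h0 | h0
  · rw [delayCoeff_of_nonpos h0, hψx x ⟨hx.1, h0⟩]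
  · rw [(hG x h0 hx.2).2, hψx 0 ⟨by linarith, le_rfl⟩,
      intervalIntegral.integral_congr_ae (Eventually.of_forall (hright x h0)), add_assoc,
      intervalIntegral.integral_add_adjacent_intervals i1 (i2 x h0 hx.2)]

theorem hasCaputoDeriv_delayCoeff (hα : 0 < α) (hα1 : α ≤ 1) (hτ : 0 < τ)
    (hψ : AbsolutelyContinuousOnInterval ψ (-τ) 0) {t : ℝ} (ht : 0 < t) :
    HasCaputoDeriv α (delayCoeff α τ κ δ c₀ ψ) t
      (κ • delayCoeff α τ κ δ c₀ ψ t + δ • delayCoeff α τ κ δ c₀ ψ (t - τ) + c₀) := by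
  -- The horizon `t + 1` leaves a full neighbourhood of `t`.
  obtain ⟨G, hG, hG1, hGlt⟩ :=
    delayCoeff_representation (κ := κ) (δ := δ) (c₀ := c₀) hα hτ hψ (t + 1)
  have hA := absolutelyContinuousOnInterval_delayCoeff (κ := κ) (δ := δ) (c₀ := c₀) hα hτ hψ
    (show 0 < t + 1 by linarith)
  set A := delayCoeff α τ κ δ c₀ ψ
  have hloc : ∀ s ∈ Ioo 0 (t + 1), A =ᶠ[𝓝 s] fun s => ψ 0 + ∫ r in (0 : ℝ)..s, G r := fun s hs => by
    filter_upwards [Ioo_mem_nhds hs.1 hs.2] with x hx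
    exact (hG x hx.1.le hx.2.le).2
  unfold HasCaputoDeriv
  split_ifs with h1
  · rw [← hG1 h1 t ht (by linarith)]
    have hmem : Ioo 0 (t + 1) ∈ 𝓝 t := Ioo_mem_nhds ht (by linarith)
    -- Near `t`, `G` is the right-hand side, continuous because `A` is; hence the primitive is
    -- differentiable at `t` itself.
    have hGe : (fun s => κ • A s + δ • A (s - τ) + c₀) =ᶠ[𝓝 t] G := by
      filter_upwards [hmem] with s hs
      exact (hG1 h1 s hs.1 hs.2.le).symm
    have hAc : ∀ s, -τ < s → s < t + 1 → ContinuousAt A s := fun s hs hs' =>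
      hA.continuousOn.continuousAt (by
        rw [uIcc_of_le (by linarith)]
        exact Icc_mem_nhds hs hs')
    have hAτ : ContinuousAt (fun s => A (s - τ)) t :=
      ContinuousAt.comp' (f := fun s => s - τ) (hAc (t - τ) (by linarith) (by linarith))
        (by fun_prop)
    have hGc : ContinuousAt G t :=
      ((((hAc t (by linarith) (by linarith)).const_smul κ).add (hAτ.const_smul δ)).add
        continuousAt_const).congr hGe
    have hmeas : StronglyMeasurableAtFilter G (𝓝 t) volume :=
      ⟨Ioc 0 (t + 1), mem_of_superset hmem Ioo_subset_Ioc_self,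
        (hG (t + 1) (by linarith) le_rfl).1.1.1⟩
    exact ((intervalIntegral.integral_hasDerivAt_right (hG t ht.le (by linarith)).1 hmeas
      hGc).const_add (ψ 0)).congr_of_eventuallyEq (hloc t ⟨ht, by linarith⟩)
  -- By Lebesgue differentiation, `A` has derivative `G` almost everywhere, which suffices under the
  -- integral.
  · have hae : ∀ᵐ s, s ∈ uIoc 0 t → (t - s) ^ (-α) • G s = (t - s) ^ (-α) • deriv A s := by
      filter_upwards [(hG (t + 1) (by linarith) le_rfl).1.ae_hasDerivAt_integral] with s hs hst
      rw [uIoc_of_le ht.le] at hst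
      have hd := hs (by rw [uIcc_of_le (by linarith)]; exact ⟨hst.1.le, by linarith [hst.2]⟩) 0
        (by simp)
      rw [((hd.const_add (ψ 0)).congr_of_eventuallyEq
        (hloc s ⟨hst.1, by linarith [hst.2]⟩)).deriv]
    obtain ⟨h2, h3⟩ := hGlt (lt_of_le_of_ne hα1 h1) t ht (by linarith)
    refine ⟨h2.congr_ae ((ae_restrict_iff' measurableSet_uIoc).2 hae), ?_⟩
    rw [← intervalIntegral.integral_congr_ae hae, h3]

end DelayCoeff

/-! ### Separation into two spatial modes -/

section TwoModes
variable {𝕜 : Type*} [RCLike 𝕜] {α τ κ₁ κ₂ δ : ℝ} {D : 𝕜 → 𝕜} {R : 𝕜 → 𝕜 → 𝕜}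

lemma iteratedDeriv_two_combination {φ₁ φ₁' φ₁'' φ₂ φ₂' φ₂'' : ℝ → 𝕜}
    (h₁ : ∀ x, HasDerivAt φ₁ (φ₁' x) x) (h₁' : ∀ x, HasDerivAt φ₁' (φ₁'' x) x)
    (h₂ : ∀ x, HasDerivAt φ₂ (φ₂' x) x) (h₂' : ∀ x, HasDerivAt φ₂' (φ₂'' x) x) (a b : 𝕜) (x : ℝ) :
    iteratedDeriv 2 (fun y => a * φ₁ y + b * φ₂ y) x = a * φ₁'' x + b * φ₂'' x := by
  have e : deriv (fun y => a * φ₁ y + b * φ₂ y) = fun y => a * φ₁' y + b * φ₂' y :=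
    funext fun y => (((h₁ y).const_mul a).add ((h₂ y).const_mul b)).deriv
  rw [iteratedDeriv_succ, iteratedDeriv_one, e]
  exact (((h₁' x).const_mul a).add ((h₂' x).const_mul b)).deriv

/-- If `heatOp` acts on the combinations of `φ₁` and `φ₂` by a decoupled affine map of the
coefficients, then the coefficient functions `delayCoeff` give a solution. -/
theorem isDelayHeatSolution_of_heatOp_eq (hα : 0 < α) (hα1 : α ≤ 1) (hτ : 0 < τ)
    {φ₁ φ₂ : ℝ → 𝕜} (hφ₁ : ContDiff ℝ 2 φ₁) (hφ₂ : ContDiff ℝ 2 φ₂) {c₁ c₂ : 𝕜}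
    (hop : ∀ a₁ a₂ b₁ b₂ x,
      heatOp D R (fun y => a₁ * φ₁ y + a₂ * φ₂ y) (fun y => b₁ * φ₁ y + b₂ * φ₂ y) x =
        (κ₁ • a₁ + δ • b₁ + c₁) * φ₁ x + (κ₂ • a₂ + δ • b₂ + c₂) * φ₂ x)
    {ψ₁ ψ₂ : ℝ → 𝕜} (hψ₁ : AbsolutelyContinuousOnInterval ψ₁ (-τ) 0)
    (hψ₂ : AbsolutelyContinuousOnInterval ψ₂ (-τ) 0) :
    IsDelayHeatSolution α τ D R (fun x t => ψ₁ t * φ₁ x + ψ₂ t * φ₂ x)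
      (fun x t => delayCoeff α τ κ₁ δ c₁ ψ₁ t * φ₁ x + delayCoeff α τ κ₂ δ c₂ ψ₂ t * φ₂ x) := by
  have hac : ∀ (κ : ℝ) (c : 𝕜) {ψ : ℝ → 𝕜}, AbsolutelyContinuousOnInterval ψ (-τ) 0 →
      ∀ (p : 𝕜) (T : ℝ), 0 < T →
        AbsolutelyContinuousOnInterval (fun t => delayCoeff α τ κ δ c ψ t * p) (-τ) T := by
    intro κ c ψ hψ p T hT
    simp only [mul_comm _ p]
    exact (absolutelyContinuousOnInterval_delayCoeff hα hτ hψ hT).const_smul p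
  refine ⟨fun x t ht => ?_, fun x T hT => ?_, fun t _ => ?_, fun x t ht => ?_⟩
  · simp only [delayCoeff_of_nonpos ht.2]
  · exact (hac κ₁ c₁ hψ₁ _ T hT).add (hac κ₂ c₂ hψ₂ _ T hT)
  · exact (contDiff_const.mul hφ₁).add (contDiff_const.mul hφ₂)
  · have hsub : uIcc 0 t ⊆ uIcc (-τ) t := by
      rw [uIcc_of_le ht.le, uIcc_of_le (by linarith)]
      exact Icc_subset_Icc_left (by linarith)
    rw [hop]
    exact ((hasCaputoDeriv_delayCoeff hα hα1 hτ hψ₁ ht).mul_const _).add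
      ((hasCaputoDeriv_delayCoeff hα hα1 hτ hψ₂ ht).mul_const _)
      ((hac κ₁ c₁ hψ₁ _ t ht).mono hsub) ((hac κ₂ c₂ hψ₂ _ t ht).mono hsub)

lemma isInvariantSubspace_span_pair {D : ℝ → ℝ} {R : ℝ → ℝ → ℝ} {φ₁ φ₂ : ℝ → ℝ} {c₁ c₂ : ℝ}
    (hop : ∀ a₁ a₂ b₁ b₂ x,
      heatOp D R (fun y => a₁ * φ₁ y + a₂ * φ₂ y) (fun y => b₁ * φ₁ y + b₂ * φ₂ y) x =
        (κ₁ • a₁ + δ • b₁ + c₁) * φ₁ x + (κ₂ • a₂ + δ • b₂ + c₂) * φ₂ x) :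
    IsInvariantSubspace (Submodule.span ℝ {φ₁, φ₂}) D R := by
  intro w hw wbar hwbar
  obtain ⟨a₁, a₂, rfl⟩ := Submodule.mem_span_pair.1 hw
  obtain ⟨b₁, b₂, rfl⟩ := Submodule.mem_span_pair.1 hwbar
  exact Submodule.mem_span_pair.2 ⟨_, _, (funext (hop a₁ a₂ b₁ b₂)).symm⟩

end TwoModes

/-! ### Action of the operator on the modes -/

section Operators

/-- Here w_xx = a₀² w, so for k ≥ 1 the condition on `c` cancels b_k w^k w_xx, and only k = 0
survives. The zero second mode fits the one-dimensional space into the two-mode setting. -/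
lemma heatOp_exp (m : ℕ) (a₀ δ : ℝ) (b c : ℕ → ℝ)
    (hc : ∀ k ∈ Finset.Icc 1 m, c (k + 1) = -a₀ ^ 2 * b k) (a₁ a₂ b₁ b₂ x : ℝ) :
    heatOp (fun v => ∑ k ∈ Finset.range (m + 1), b k * v ^ k)
      (fun v vbar => (∑ k ∈ Finset.range (m + 1), c (k + 1) * v ^ (k + 1)) + δ * vbar)
      (fun y => a₁ * Real.exp (-a₀ * y) + a₂ * 0) (fun y => b₁ * Real.exp (-a₀ * y) + b₂ * 0) x =
    ((a₀ ^ 2 * b 0 + c 1) • a₁ + δ • b₁ + 0) * Real.exp (-a₀ * x) +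
      ((0 : ℝ) • a₂ + δ • b₂ + 0) * 0 := by
  have h1 : ∀ (q x : ℝ), HasDerivAt (fun y => q * Real.exp (-a₀ * y))
      (-a₀ * q * Real.exp (-a₀ * x)) x := fun q x => by
    have := (((hasDerivAt_id x).const_mul (-a₀)).exp).const_mul q
    convert! this using 1
    simp only [id]
    ring
  have h0 : ∀ x : ℝ, HasDerivAt (fun _ : ℝ => (0 : ℝ)) 0 x := fun x => hasDerivAt_const x 0
  have h := iteratedDeriv_two_combination (φ₁ := fun y => Real.exp (-a₀ * y))
    (fun x => by simpa using h1 1 x) (h1 (-a₀)) h0 h0 a₁ a₂ x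
  rw [heatOp, h, Finset.sum_range_succ', Finset.sum_range_succ']
  set w := Real.exp (-a₀ * x)
  have e : ∑ k ∈ Finset.range m, c (k + 1 + 1) * (a₁ * w + a₂ * 0) ^ (k + 1 + 1) =
      -a₀ ^ 2 * (a₁ * w) * ∑ k ∈ Finset.range m, b (k + 1) * (a₁ * w + a₂ * 0) ^ (k + 1) := by
    rw [Finset.mul_sum]
    refine Finset.sum_congr rfl fun k hk => ?_
    rw [hc (k + 1) (Finset.mem_Icc.2 ⟨by omega, by simpa [Nat.succ_le_iff] using hk⟩)]
    ring
  rw [e]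
  simp only [smul_eq_mul]
  ring

lemma heatOp_affine (D : ℝ → ℝ) (c₀ c₁ δ a₁ a₂ b₁ b₂ x : ℝ) :
    heatOp D (fun v vbar => c₁ * v + δ * vbar + c₀) (fun y => a₁ * 1 + a₂ * y)
      (fun y => b₁ * 1 + b₂ * y) x =
    (c₁ • a₁ + δ • b₁ + c₀) * 1 + (c₁ • a₂ + δ • b₂ + 0) * x := by
  have h := iteratedDeriv_two_combination (𝕜 := ℝ) (fun x => hasDerivAt_const x (1 : ℝ))
    (fun x => hasDerivAt_const x (0 : ℝ)) (fun x => hasDerivAt_id' x)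
    (fun x => hasDerivAt_const x (1 : ℝ)) a₁ a₂ x
  rw [heatOp, h]
  simp only [smul_eq_mul]
  ring

/-- Since w_xx = -a₀ w, the quadratic and cubic terms cancel and -a₀ b₀ w remains. The sign of `a₀`
plays no role, which lets the real and complex cases share this computation. -/
lemma heatOp_of_eigen {𝕜 : Type*} [RCLike 𝕜] {φ₁ φ₁' φ₂ φ₂' : ℝ → 𝕜} (a₀ b₀ b₁ b₂ c₁ δ : ℝ)
    (h₁ : ∀ x, HasDerivAt φ₁ (φ₁' x) x) (h₁' : ∀ x, HasDerivAt φ₁' (-a₀ * φ₁ x) x)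
    (h₂ : ∀ x, HasDerivAt φ₂ (φ₂' x) x) (h₂' : ∀ x, HasDerivAt φ₂' (-a₀ * φ₂ x) x)
    (p₁ p₂ q₁ q₂ : 𝕜) (x : ℝ) :
    heatOp (fun v : 𝕜 => b₂ * v ^ 2 + b₁ * v + b₀)
      (fun v vbar : 𝕜 => a₀ * b₂ * v ^ 3 + b₁ * a₀ * v ^ 2 + c₁ * v + δ * vbar)
      (fun y => p₁ * φ₁ y + p₂ * φ₂ y) (fun y => q₁ * φ₁ y + q₂ * φ₂ y) x =
    ((c₁ - a₀ * b₀) • p₁ + δ • q₁ + 0) * φ₁ x + ((c₁ - a₀ * b₀) • p₂ + δ • q₂ + 0) * φ₂ x := by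
  rw [heatOp, iteratedDeriv_two_combination h₁ h₁' h₂ h₂']
  simp only [RCLike.real_smul_eq_coe_mul, RCLike.ofReal_sub, RCLike.ofReal_mul]
  ring

end Operators

/-! ### Real and complex trigonometric modes -/

section Trigonometric

lemma contDiff_cos_mul_ofReal (s : ℂ) : ContDiff ℝ 2 fun x : ℝ => Complex.cos (s * x) :=
  (Complex.contDiff_cos.restrict_scalars ℝ).comp (contDiff_const.mul Complex.ofRealCLM.contDiff)

lemma contDiff_sin_mul_ofReal (s : ℂ) : ContDiff ℝ 2 fun x : ℝ => Complex.sin (s * x) :=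
  (Complex.contDiff_sin.restrict_scalars ℝ).comp (contDiff_const.mul Complex.ofRealCLM.contDiff)

lemma hasDerivAt_mul_cos_mul_ofReal (q s : ℂ) (x : ℝ) :
    HasDerivAt (fun x : ℝ => q * Complex.cos (s * x)) (-(q * s) * Complex.sin (s * x)) x := by
  have h : HasDerivAt (fun z : ℂ => q * Complex.cos (s * z)) (-(q * s) * Complex.sin (s * x)) x := by
    convert! (((hasDerivAt_id (x : ℂ)).const_mul s).ccos).const_mul q using 1
    simp only [id]
    ring
  exact h.comp_ofReal

lemma hasDerivAt_mul_sin_mul_ofReal (q s : ℂ) (x : ℝ) :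
    HasDerivAt (fun x : ℝ => q * Complex.sin (s * x)) (q * s * Complex.cos (s * x)) x := by
  have h : HasDerivAt (fun z : ℂ => q * Complex.sin (s * z)) (q * s * Complex.cos (s * x)) x := by
    convert! (((hasDerivAt_id (x : ℂ)).const_mul s).csin).const_mul q using 1
    simp only [id]
    ring
  exact h.comp_ofReal

lemma hasDerivAt_mul_cos_mul (q s x : ℝ) :
    HasDerivAt (fun x : ℝ => q * Real.cos (s * x)) (-(q * s) * Real.sin (s * x)) x := by
  convert! (((hasDerivAt_id x).const_mul s).cos).const_mul q using 1
  simp only [id]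
  ring

lemma hasDerivAt_mul_sin_mul (q s x : ℝ) :
    HasDerivAt (fun x : ℝ => q * Real.sin (s * x)) (q * s * Real.cos (s * x)) x := by
  convert! (((hasDerivAt_id x).const_mul s).sin).const_mul q using 1
  simp only [id]
  ring

lemma heatOp_trig (a₀ b₀ b₁ b₂ c₁ δ : ℝ) (ha : 0 ≤ a₀) (p₁ p₂ q₁ q₂ x : ℝ) :
    heatOp (fun v => b₂ * v ^ 2 + b₁ * v + b₀)
      (fun v vbar => a₀ * b₂ * v ^ 3 + b₁ * a₀ * v ^ 2 + c₁ * v + δ * vbar)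
      (fun y => p₁ * Real.cos (√a₀ * y) + p₂ * Real.sin (√a₀ * y))
      (fun y => q₁ * Real.cos (√a₀ * y) + q₂ * Real.sin (√a₀ * y)) x =
    ((c₁ - a₀ * b₀) • p₁ + δ • q₁ + 0) * Real.cos (√a₀ * x) +
      ((c₁ - a₀ * b₀) • p₂ + δ • q₂ + 0) * Real.sin (√a₀ * x) := by
  have hs := Real.mul_self_sqrt ha
  refine heatOp_of_eigen (𝕜 := ℝ) (φ₁' := fun x => -√a₀ * Real.sin (√a₀ * x))
    (φ₂' := fun x => √a₀ * Real.cos (√a₀ * x)) a₀ b₀ b₁ b₂ c₁ δ (fun x => ?_) (fun x => ?_)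
    (fun x => ?_) (fun x => ?_) p₁ p₂ q₁ q₂ x
  · simpa using hasDerivAt_mul_cos_mul 1 (√a₀) x
  · simpa [hs] using hasDerivAt_mul_sin_mul (-√a₀) (√a₀) x
  · simpa using hasDerivAt_mul_sin_mul 1 (√a₀) x
  · simpa [hs] using hasDerivAt_mul_cos_mul (√a₀) (√a₀) x

lemma heatOp_complex_trig (a₀ b₀ b₁ b₂ c₁ δ : ℝ) {s : ℂ} (hs : s ^ 2 = (a₀ : ℂ))
    (p₁ p₂ q₁ q₂ : ℂ) (x : ℝ) :
    heatOp (fun v : ℂ => b₂ * v ^ 2 + b₁ * v + b₀)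
      (fun v vbar : ℂ => a₀ * b₂ * v ^ 3 + b₁ * a₀ * v ^ 2 + c₁ * v + δ * vbar)
      (fun y => p₁ * Complex.cos (s * y) + p₂ * Complex.sin (s * y))
      (fun y => q₁ * Complex.cos (s * y) + q₂ * Complex.sin (s * y)) x =
    ((c₁ - a₀ * b₀) • p₁ + δ • q₁ + 0) * Complex.cos (s * x) +
      ((c₁ - a₀ * b₀) • p₂ + δ • q₂ + 0) * Complex.sin (s * x) := by
  have hs' : s * s = a₀ := by rw [← hs, sq]
  refine heatOp_of_eigen (𝕜 := ℂ) (φ₁' := fun x => -s * Complex.sin (s * x))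
    (φ₂' := fun x => s * Complex.cos (s * x)) a₀ b₀ b₁ b₂ c₁ δ (fun x => ?_) (fun x => ?_)
    (fun x => ?_) (fun x => ?_) p₁ p₂ q₁ q₂ x
  · simpa using hasDerivAt_mul_cos_mul_ofReal 1 s x
  · simpa [hs'] using hasDerivAt_mul_sin_mul_ofReal (-s) s x
  · simpa using hasDerivAt_mul_sin_mul_ofReal 1 s x
  · simpa [hs'] using hasDerivAt_mul_cos_mul_ofReal s s x

end Trigonometric

end

theorem mainTheorem6 (α τ δ : ℝ) (hα : 0 < α) (hα1 : α ≤ 1) (hτ : 0 < τ) :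
    -- the exponential family
    (∀ (m : ℕ) (a₀ : ℝ) (b c : ℕ → ℝ), (∀ k ∈ Finset.Icc 1 m, c (k + 1) = -a₀ ^ 2 * b k) →
      IsInvariantSubspace (Submodule.span ℝ {fun x => Real.exp (-a₀ * x)})
        (fun v => ∑ k ∈ Finset.range (m + 1), b k * v ^ k)
        (fun v vbar => (∑ k ∈ Finset.range (m + 1), c (k + 1) * v ^ (k + 1)) + δ * vbar) ∧
      ∀ ξ : ℝ → ℝ, AbsolutelyContinuousOnInterval ξ (-τ) 0 →
        IsDelayHeatSolution α τ
          (fun v => ∑ k ∈ Finset.range (m + 1), b k * v ^ k)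
          (fun v vbar => (∑ k ∈ Finset.range (m + 1), c (k + 1) * v ^ (k + 1)) + δ * vbar)
          (fun x t => ξ t * Real.exp (-a₀ * x))
          (fun x t => delayCoeff α τ (a₀ ^ 2 * b 0 + c 1) δ 0 ξ t * Real.exp (-a₀ * x))) ∧
    -- the polynomial family
    (∀ (D : ℝ → ℝ) (c₀ c₁ : ℝ),
      IsInvariantSubspace (Submodule.span ℝ {fun _ => 1, fun x => x})
        D (fun v vbar => c₁ * v + δ * vbar + c₀) ∧
      ∀ ψ χ : ℝ → ℝ, AbsolutelyContinuousOnInterval ψ (-τ) 0 →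
        AbsolutelyContinuousOnInterval χ (-τ) 0 →
        IsDelayHeatSolution α τ D (fun v vbar => c₁ * v + δ * vbar + c₀)
          (fun x t => ψ t + χ t * x)
          (fun x t => delayCoeff α τ c₁ δ c₀ ψ t + delayCoeff α τ c₁ δ 0 χ t * x)) ∧
    -- the trigonometric family, for nonnegative `a₀` and real solutions
    (∀ a₀ b₀ b₁ b₂ c₁ : ℝ, 0 ≤ a₀ →
      IsInvariantSubspace
        (Submodule.span ℝ {fun x => Real.cos (√a₀ * x), fun x => Real.sin (√a₀ * x)})
        (fun v => b₂ * v ^ 2 + b₁ * v + b₀)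
        (fun v vbar => a₀ * b₂ * v ^ 3 + b₁ * a₀ * v ^ 2 + c₁ * v + δ * vbar) ∧
      ∀ χ ω : ℝ → ℝ, AbsolutelyContinuousOnInterval χ (-τ) 0 →
        AbsolutelyContinuousOnInterval ω (-τ) 0 →
        IsDelayHeatSolution α τ
          (fun v => b₂ * v ^ 2 + b₁ * v + b₀)
          (fun v vbar => a₀ * b₂ * v ^ 3 + b₁ * a₀ * v ^ 2 + c₁ * v + δ * vbar)
          (fun x t => χ t * Real.cos (√a₀ * x) + ω t * Real.sin (√a₀ * x))
          (fun x t => delayCoeff α τ (c₁ - a₀ * b₀) δ 0 χ t * Real.cos (√a₀ * x)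
            + delayCoeff α τ (c₁ - a₀ * b₀) δ 0 ω t * Real.sin (√a₀ * x))) ∧
    -- the trigonometric family, for real `a₀` of any sign, with a complex square root `s` of `a₀`
    (∀ (a₀ b₀ b₁ b₂ c₁ : ℝ) (s : ℂ), s ^ 2 = (a₀ : ℂ) →
      ∀ χ ω : ℝ → ℂ, AbsolutelyContinuousOnInterval χ (-τ) 0 →
        AbsolutelyContinuousOnInterval ω (-τ) 0 →
        IsDelayHeatSolution α τ
          (fun v : ℂ => b₂ * v ^ 2 + b₁ * v + b₀)
          (fun v vbar : ℂ => a₀ * b₂ * v ^ 3 + b₁ * a₀ * v ^ 2 + c₁ * v + δ * vbar)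
          (fun x t => χ t * Complex.cos (s * x) + ω t * Complex.sin (s * x))
          (fun x t => delayCoeff α τ (c₁ - a₀ * b₀) δ 0 χ t * Complex.cos (s * x)
            + delayCoeff α τ (c₁ - a₀ * b₀) δ 0 ω t * Complex.sin (s * x))) := by
  refine ⟨fun m a₀ b c hc => ⟨?_, fun ξ hξ => ?_⟩, fun D c₀ c₁ => ⟨?_, fun ψ χ hψ hχ => ?_⟩,
    fun a₀ b₀ b₁ b₂ c₁ ha => ⟨?_, fun χ ω hχ hω => ?_⟩, fun a₀ b₀ b₁ b₂ c₁ s hs χ ω hχ hω => ?_⟩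
  · have h := isInvariantSubspace_span_pair (φ₂ := fun _ => 0) (heatOp_exp m a₀ δ b c hc)
    have e : Submodule.span ℝ {fun x => Real.exp (-a₀ * x), fun _ : ℝ => (0 : ℝ)} =
        Submodule.span ℝ {fun x => Real.exp (-a₀ * x)} := by
      rw [Set.pair_comm]
      exact Submodule.span_insert_zero
    rwa [e] at h
  -- The second mode is zero, so any admissible history serves for it; `ξ` is reused.
  · have h := isDelayHeatSolution_of_heatOp_eq hα hα1 hτ (φ₁ := fun x => Real.exp (-a₀ * x))
      (φ₂ := fun _ => 0) (by fun_prop) contDiff_const (heatOp_exp m a₀ δ b c hc) hξ hξ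
    simpa only [mul_zero, add_zero] using h
  · exact isInvariantSubspace_span_pair (heatOp_affine D c₀ c₁ δ)
  · have h := isDelayHeatSolution_of_heatOp_eq hα hα1 hτ (φ₁ := fun _ => (1 : ℝ))
      (φ₂ := fun x => x) contDiff_const contDiff_id (heatOp_affine D c₀ c₁ δ) hψ hχ
    simpa only [mul_one] using h
  · exact isInvariantSubspace_span_pair (heatOp_trig a₀ b₀ b₁ b₂ c₁ δ ha)
  · exact isDelayHeatSolution_of_heatOp_eq hα hα1 hτ (by fun_prop) (by fun_prop)
      (heatOp_trig a₀ b₀ b₁ b₂ c₁ δ ha) hχ hω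
  · exact isDelayHeatSolution_of_heatOp_eq hα hα1 hτ (contDiff_cos_mul_ofReal s)
      (contDiff_sin_mul_ofReal s) (heatOp_complex_trig a₀ b₀ b₁ b₂ c₁ δ hs) hχ hω
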